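/- Let $n\ge 2$ and $\alpha\in(\frac1n,1+\frac1n)$. Let $M^n$ be a closed (compact, without boundary) smooth $n$-manifold and let $F:M^n\to\mathbb R^{n+1}$ be a smooth immersion whose image $\Sigma=F(M^n)$ is strictly convex: with respect to the interior unit normal $\vec n$ (the unit normal for which the second fundamental form $h_{ij}=\langle\nabla_i\nabla_jF,\vec n\rangle$ is positive definite) all principal curvatures are positive. Let $g_{ij}=\langle\nabla_iF,\nabla_jF\rangle$ be the induced metric, $K=\det(h_{ij})/\det(g_{ij})$ the Gauss curvature, and $\lambda_{\min}$ the smallest principal curvature, and suppose that $$K^\alpha(p)=-\langle F(p),\vec n(p)\rangle\qquad\text{for all }p\in M^n .$$ If the function $$w(p)=K^\alpha(p)\,\lambda_{\min}^{-1}(p)-\frac{n\alpha-1}{2n\alpha}\,|F(p)|^2$$ attains its maximum over $M^n$ at a point $p_0$, then $F(p_0)$ is an umbilical point (all principal curvatures at $p_0$ are equal) and $\nabla|F|^2(p_0)=0$. -/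

import Mathlib

open scoped Manifold ContDiff

noncomputable section

namespace GaussShrinker

variable {n : ℕ} {M : Type*} [TopologicalSpace M] [ChartedSpace (EuclideanSpace ℝ (Fin n)) M]

/-- A map `F : M → ℝⁿ⁺¹` read in the preferred chart of `M` around `p`. -/
def localRep (F : M → EuclideanSpace ℝ (Fin (n + 1))) (p : M) :
    EuclideanSpace ℝ (Fin n) → EuclideanSpace ℝ (Fin (n + 1)) :=
  F ∘ (extChartAt (𝓡 n) p).symm

/-- The tangent vector `F_i = ∂_i F` at `p`, in the preferred chart around `p`. -/
def partialDeriv (F : M → EuclideanSpace ℝ (Fin (n + 1))) (p : M) (i : Fin n) :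
    EuclideanSpace ℝ (Fin (n + 1)) :=
  fderiv ℝ (localRep F p) (extChartAt (𝓡 n) p p) (EuclideanSpace.single i 1)

/-- The second derivative `∂_i ∂_j F` at `p`, in the preferred chart around `p`. -/
def partialDeriv₂ (F : M → EuclideanSpace ℝ (Fin (n + 1))) (p : M) (i j : Fin n) :
    EuclideanSpace ℝ (Fin (n + 1)) :=
  fderiv ℝ (fderiv ℝ (localRep F p)) (extChartAt (𝓡 n) p p)
    (EuclideanSpace.single i 1) (EuclideanSpace.single j 1)

/-- The first fundamental form `g_ij = ⟨F_i, F_j⟩` at `p`. -/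
def metricMatrix (F : M → EuclideanSpace ℝ (Fin (n + 1))) (p : M) :
    Matrix (Fin n) (Fin n) ℝ :=
  Matrix.of fun i j => inner ℝ (partialDeriv F p i) (partialDeriv F p j)

/-- The second fundamental form `h_ij = ⟨∂_i ∂_j F, ν⟩` at `p` with respect to the unit normal `ν`.
As `ν p` is normal, this is also `⟨∇_i ∇_j F, ν⟩`, and it transforms as a tensor under changes of
chart. -/
def secondFundMatrix (F ν : M → EuclideanSpace ℝ (Fin (n + 1))) (p : M) :
    Matrix (Fin n) (Fin n) ℝ :=
  Matrix.of fun i j => inner ℝ (partialDeriv₂ F p i j) (ν p)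

/-- The matrix `g^{ik} h_{kj}` of the Weingarten map at `p`. -/
def weingartenMatrix (F ν : M → EuclideanSpace ℝ (Fin (n + 1))) (p : M) :
    Matrix (Fin n) (Fin n) ℝ :=
  (metricMatrix F p)⁻¹ * secondFundMatrix F ν p

/-- The set of principal curvatures at `p`: the eigenvalues of the Weingarten map. -/
def principalCurvatures (F ν : M → EuclideanSpace ℝ (Fin (n + 1))) (p : M) : Set ℝ :=
  {c | Module.End.HasEigenvalue (Matrix.toLin' (weingartenMatrix F ν p)) c}

/-- The Gauss curvature `K` at `p`: the determinant of the Weingarten map, that is, the product of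
the principal curvatures with multiplicity. -/
def gaussCurvature (F ν : M → EuclideanSpace ℝ (Fin (n + 1))) (p : M) : ℝ :=
  (weingartenMatrix F ν p).det

/-- The smallest principal curvature `λ_min` at `p` (the set of principal curvatures of an immersed
hypersurface of dimension `n ≥ 1` is finite and non-empty). -/
def minPrincipalCurvature (F ν : M → EuclideanSpace ℝ (Fin (n + 1))) (p : M) : ℝ :=
  sInf (principalCurvatures F ν p)

/-- `F : M → ℝⁿ⁺¹` is a smooth immersion. -/
structure IsSmoothImmersion (F : M → EuclideanSpace ℝ (Fin (n + 1))) : Prop where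
  contMDiff : ContMDiff (𝓡 n) 𝓘(ℝ, EuclideanSpace ℝ (Fin (n + 1))) ∞ F
  injective_mfderiv : ∀ p : M,
    Function.Injective (mfderiv (𝓡 n) 𝓘(ℝ, EuclideanSpace ℝ (Fin (n + 1))) F p)

/-- `F` parametrizes a strictly convex hypersurface with interior unit normal `ν`: `ν` is a unit
normal field and the second fundamental form with respect to `ν` is positive definite, so that all
principal curvatures are positive. This positivity says that the hypersurface curves towards the
side of `ν`, so for the boundary of a convex body it singles out the interior one of the two unit
normals; at each point at most one `ν p` satisfies it when `n ≥ 1`. -/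
structure IsStrictlyConvexWithInteriorNormal (F ν : M → EuclideanSpace ℝ (Fin (n + 1))) :
    Prop where
  norm_eq_one : ∀ p, ‖ν p‖ = 1
  orthogonal : ∀ p i, inner ℝ (partialDeriv F p i) (ν p) = 0
  posDef : ∀ p, (secondFundMatrix F ν p).PosDef

/-- The equation `K^α = -⟨F, ν⟩` of self-similar solutions of the `α`-Gauss curvature flow. -/
def IsShrinker (α : ℝ) (F ν : M → EuclideanSpace ℝ (Fin (n + 1))) : Prop :=
  ∀ p, gaussCurvature F ν p ^ α = -inner ℝ (F p) (ν p)

/-- The function `w = K^α λ_min⁻¹ - (nα - 1) / (2nα) |F|²`. -/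
def wFun (α : ℝ) (F ν : M → EuclideanSpace ℝ (Fin (n + 1))) (p : M) : ℝ :=
  gaussCurvature F ν p ^ α * (minPrincipalCurvature F ν p)⁻¹
    - (n * α - 1) / (2 * n * α) * ‖F p‖ ^ 2

/-- `F p` is an umbilical point: the second fundamental form is a multiple of the metric, that is,
all principal curvatures at `p` coincide. -/
def IsUmbilic (F ν : M → EuclideanSpace ℝ (Fin (n + 1))) (p : M) : Prop :=
  ∃ c : ℝ, secondFundMatrix F ν p = c • metricMatrix F p

end GaussShrinker

end

namespace GaussShrinker

open Filter Topology Matrix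

/-! The argument is a maximum principle for the support function near `p₀`. Since the second
fundamental form is definite, the hypersurface is locally parametrized by its exterior normal
direction `w 0 + z`, with `z` in the tangent space at `p₀` (`exists_support_function`). Let `v z` be
the inner product of the position with `w 0 + z`, put `ρ² = 1 + |z|²` and `β = 1/α`. Then `|F|² =
|Dv|² + (v - z·Dv)²`, the Gauss curvature is `1 / (ρ^(n+2) det D²v)`, and the shrinker equation
becomes `log det D²v = -((n+2-β)/2) log(1+|z|²) - β log v`.

The function `w` need not be smooth where `λ_min` is a multiple eigenvalue. It is replaced by a
family of smooth inequalities: with `W` the maximum of `w` and `2c = 1 - β/n`, one has `v D²v(ξ,ξ) ≤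
(W + c|F|²)(|ξ+tz|² + t²)` for all `ξ` and `t`, with equality at `z = 0` for a unit `ξ` in the
direction of the largest principal radius (`exists_least_curvature`). Restricting to lines through
the origin, with `ξ` and `t` moving along the line, gives ordinary first and second derivative tests
(`umbilic_of_support_function`).

The rest is algebra at one point (`eq_of_second_order_inequalities`). The second order inequalities
are divided by the radii `μ i` and summed, and the fourth derivatives are eliminated by
differentiating the equation twice in the direction `o` of the largest radius. The first order
condition and Cauchy-Schwarz control the third derivatives. What remains is that a sum of
nonnegative terms, containing positive multiples of `∑ (μ o - μ i)` and `d o ^ 2 / v`, is at most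
zero. So all radii agree and `d o = 0`; the other components of `Dv` vanish because their directions
share the largest radius. Thus the point is umbilic and `F` is normal there. -/

/-! ### One-variable second derivative tests. -/

/-- Necessary second order condition at a local maximum on the line. -/
theorem IsLocalMax.second_deriv_nonpos {φ φ' : ℝ → ℝ} {d : ℝ}
    (h : ∀ t, HasDerivAt φ (φ' t) t) (h' : HasDerivAt φ' d 0) (hmax : IsLocalMax φ 0) :
    φ' 0 = 0 ∧ d ≤ 0 := by
  have h0 : φ' 0 = 0 := hmax.hasDerivAt_eq_zero (h 0)
  refine ⟨h0, ?_⟩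
  by_contra! hd
  have hφ' : deriv φ = φ' := funext fun t => (h t).deriv
  -- A positive second derivative would make the maximum also a local minimum, so `φ` would be
  -- locally constant and `d = 0`.
  have hmin : IsLocalMin φ 0 :=
    isLocalMin_of_deriv_deriv_pos (by rw [hφ', h'.deriv]; exact hd) (by rw [hφ', h0])
      (h 0).continuousAt
  have hc : φ =ᶠ[𝓝 0] fun _ => φ 0 := by
    filter_upwards [hmax, hmin] with t h1 h2 using le_antisymm h1 h2
  have h1 : φ' =ᶠ[𝓝 0] fun _ => 0 := by
    rw [← hφ']
    refine hc.deriv.trans ?_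
    simp
  have h2 := h1.deriv_eq
  rw [h'.deriv, deriv_const] at h2
  exact hd.ne' h2

/-- In the application `p` is `v` along a line, and `q`, `r`, `w` are `D²v` on the pairs `(b o, b
o)`, `(b o, a)`, `(a, a)`, so the bracket is `D²v` on the moving vector `b o + t a`. The factor `A`
is `W + c|F|²`, and the polynomial is the squared length `|ξ+tz|² + t²` along the line. -/
theorem second_deriv_test_of_quadratic_frame {p p₁ q q₁ r r₁ w w₁ A A₁ : ℝ → ℝ}
    {p₂ q₂ r₂ A₂ κ ε : ℝ}
    (hp : ∀ t, HasDerivAt p (p₁ t) t) (hp₁ : HasDerivAt p₁ p₂ 0)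
    (hq : ∀ t, HasDerivAt q (q₁ t) t) (hq₁ : HasDerivAt q₁ q₂ 0)
    (hr : ∀ t, HasDerivAt r (r₁ t) t) (hr₁ : HasDerivAt r₁ r₂ 0)
    (hw : ∀ t, HasDerivAt w (w₁ t) t) (hw₁ : ContinuousAt w₁ 0)
    (hA : ∀ t, HasDerivAt A (A₁ t) t) (hA₁ : HasDerivAt A₁ A₂ 0)
    (hmax : ∀ᶠ t in 𝓝 (0 : ℝ), p t * (q t + 2 * t * r t + t ^ 2 * w t)
      ≤ A t * (1 + κ * t ^ 2 + ε * t ^ 4))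
    (h0 : p 0 * q 0 = A 0) :
    p₁ 0 * q 0 + p 0 * q₁ 0 + 2 * p 0 * r 0 = A₁ 0 ∧
    p₂ * q 0 + 2 * p₁ 0 * q₁ 0 + p 0 * q₂ + 4 * (p₁ 0 * r 0 + p 0 * r₁ 0) + 2 * p 0 * w 0
      ≤ A₂ + 2 * κ * A 0 := by
  have ht : ∀ t : ℝ, HasDerivAt (fun t : ℝ => t) 1 t := fun t => hasDerivAt_id t
  have hφ : ∀ t, HasDerivAt (fun t => p t * (q t + 2 * t * r t + t ^ 2 * w t)
      - A t * (1 + κ * t ^ 2 + ε * t ^ 4))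
      (p₁ t * (q t + 2 * t * r t + t ^ 2 * w t)
        + p t * (q₁ t + (2 * r t + 2 * t * r₁ t) + (2 * t * w t + t * (t * w₁ t)))
        - (A₁ t * (1 + κ * t ^ 2 + ε * t ^ 4) + A t * (2 * κ * t + 4 * ε * t ^ 3))) t := by
    intro t
    refine HasDerivAt.congr_deriv (((hp t).mul (((hq t).add (((ht t).const_mul 2).mul (hr t))).add
      (((ht t).pow 2).mul (hw t)))).sub ((hA t).mul ((((ht t).pow 2).const_mul κ).const_add 1 |>.add
        (((ht t).pow 4).const_mul ε)))) ?_
    simp only [Pi.add_apply, Pi.mul_apply, Pi.pow_apply]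
    ring
  -- The function `w` is only assumed to have a derivative continuous at `0`; the factor `t`
  -- supplies the missing differentiability.
  have htw : HasDerivAt (fun t => t * w₁ t) (w₁ 0) 0 := by
    refine hasDerivAt_iff_tendsto_slope_zero.2 ?_
    have hw' : Tendsto w₁ (𝓝[≠] 0) (𝓝 (w₁ 0)) := hw₁.tendsto.mono_left nhdsWithin_le_nhds
    refine hw'.congr' ?_
    filter_upwards [self_mem_nhdsWithin] with t htne
    have : t ≠ 0 := htne
    simp [this]
  have hφ' := ((hp₁.mul (((hq 0).add (((ht 0).const_mul 2).mul (hr 0))).add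
      (((ht 0).pow 2).mul (hw 0)))).add ((hp 0).mul ((hq₁.add (((hr 0).const_mul 2).add
        (((ht 0).const_mul 2).mul hr₁))).add ((((ht 0).const_mul 2).mul (hw 0)).add
        ((ht 0).mul htw))))).sub
      ((hA₁.mul ((((ht 0).pow 2).const_mul κ).const_add 1 |>.add
        (((ht 0).pow 4).const_mul ε))).add ((hA 0).mul (((ht 0).const_mul (2 * κ)).add
          (((ht 0).pow 3).const_mul (4 * ε)))))
  have hm : IsLocalMax (fun t => p t * (q t + 2 * t * r t + t ^ 2 * w t)
      - A t * (1 + κ * t ^ 2 + ε * t ^ 4)) 0 := by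
    filter_upwards [hmax] with t ht
    simp only [mul_zero, zero_mul, add_zero, ne_eq, OfNat.ofNat_ne_zero, not_false_eq_true,
      zero_pow, mul_one, h0, sub_self]
    linarith
  obtain ⟨e1, e2⟩ := IsLocalMax.second_deriv_nonpos hφ hφ' hm
  simp only [Pi.add_apply, Pi.mul_apply, Pi.pow_apply] at e1 e2
  constructor
  · ring_nf at e1 ⊢
    linarith
  · ring_nf at e2 ⊢
    linarith

/-! ### Derivatives of `log det` along a curve of matrices. -/

section LogDet

variable {ι : Type*} [Fintype ι] [DecidableEq ι]

/-- Jacobi's formula for the derivative of the determinant. -/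
theorem hasDerivAt_det {M : ℝ → Matrix ι ι ℝ} {M' : Matrix ι ι ℝ} {s : ℝ}
    (h : ∀ i j, HasDerivAt (fun t => M t i j) (M' i j) s) :
    HasDerivAt (fun t => (M t).det) ((M s).adjugate * M').trace s := by
  let D : ContinuousMultilinearMap ℝ (fun _ : ι => ι → ℝ) ℝ :=
    { toMultilinearMap := (detRowAlternating (n := ι) (R := ℝ)).toMultilinearMap
      cont := (continuous_id.matrix_det : Continuous fun A : Matrix ι ι ℝ => A.det) }
  have hM : HasDerivAt (fun t => (M t : ι → ι → ℝ)) (M' : ι → ι → ℝ) s :=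
    hasDerivAt_pi.2 fun i => hasDerivAt_pi.2 fun j => h i j
  have h1 := (D.hasFDerivAt (M s : ι → ι → ℝ)).comp_hasDerivAt s hM
  refine h1.congr_deriv ((ContinuousMultilinearMap.linearDeriv_apply _ _ _).trans ?_)
  have h2 : ∀ i, D (Function.update (M s : ι → ι → ℝ) i (M' i)) =
      ∑ j, (M s).adjugate j i * M' i j := by
    intro i
    change ((M s).updateRow i (M' i)).det = _
    rw [← cramer_transpose_apply, cramer_eq_adjugate_mulVec, ← adjugate_transpose]
    simp [mulVec, dotProduct]
  rw [Finset.sum_congr rfl fun i _ => h2 i, Finset.sum_comm]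
  simp [trace, Matrix.mul_apply]

theorem hasDerivAt_log_det {M : ℝ → Matrix ι ι ℝ} {M' : Matrix ι ι ℝ} {s : ℝ}
    (h : ∀ i j, HasDerivAt (fun t => M t i j) (M' i j) s) (hdet : (M s).det ≠ 0) :
    HasDerivAt (fun t => Real.log (M t).det) ((M s)⁻¹ * M').trace s := by
  convert (hasDerivAt_det h).log hdet using 1
  rw [Matrix.inv_def, smul_mul_assoc, trace_smul, Ring.inverse_eq_inv', smul_eq_mul]
  field_simp

theorem differentiableAt_inv_apply {M : ℝ → Matrix ι ι ℝ} {s : ℝ}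
    (h : ∀ i j, DifferentiableAt ℝ (fun t => M t i j) s) (hdet : (M s).det ≠ 0) (i j : ι) :
    DifferentiableAt ℝ (fun t => (M t)⁻¹ i j) s := by
  have hd : ∀ N : ℝ → Matrix ι ι ℝ, (∀ i j, DifferentiableAt ℝ (fun t => N t i j) s) →
      DifferentiableAt ℝ (fun t => (N t).det) s := fun N hN =>
    (hasDerivAt_det (M' := of fun i j => deriv (fun t => N t i j) s)
      fun i j => (hN i j).hasDerivAt).differentiableAt
  simp only [Matrix.inv_def, Ring.inverse_eq_inv', Matrix.smul_apply, smul_eq_mul, adjugate_apply]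
  refine ((hd M h).inv hdet).mul (hd _ fun k l => ?_)
  by_cases hk : k = j
  · subst hk; simp
  · simpa [Matrix.updateRow_ne hk] using h k l

/-- First and second derivative of `log det` along a curve of matrices that is diagonal at `0`. -/
theorem hasDerivAt_log_det_diagonal {M M' : ℝ → Matrix ι ι ℝ} {M'' : Matrix ι ι ℝ} {μ : ι → ℝ}
    (h : ∀ t i j, HasDerivAt (fun t => M t i j) (M' t i j) t)
    (h' : ∀ i j, HasDerivAt (fun t => M' t i j) (M'' i j) 0)
    (h0 : M 0 = diagonal μ) (hμ : ∀ i, μ i ≠ 0) :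
    ∃ L : ℝ → ℝ, (∀ᶠ t in 𝓝 0, HasDerivAt (fun t => Real.log (M t).det) (L t) t) ∧
      L 0 = ∑ i, M' 0 i i / μ i ∧
      HasDerivAt L (∑ i, M'' i i / μ i - ∑ i, ∑ j, M' 0 i j * M' 0 j i / (μ i * μ j)) 0 := by
  have hdet0 : (M 0).det ≠ 0 := by
    rw [h0, det_diagonal]; exact Finset.prod_ne_zero_iff.2 fun i _ => hμ i
  have hcont : ContinuousAt (fun t => (M t).det) 0 := (hasDerivAt_det (h 0)).continuousAt
  have hdet : ∀ᶠ t in 𝓝 (0 : ℝ), (M t).det ≠ 0 := hcont.eventually_ne hdet0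
  have hinv0 : (M 0)⁻¹ = diagonal fun i => (μ i)⁻¹ := by
    apply Matrix.inv_eq_right_inv
    rw [h0, diagonal_mul_diagonal]
    simp [hμ]
  have hN : ∀ i j, HasDerivAt (fun t => (M t)⁻¹ i j) (-(M' 0 i j / (μ i * μ j))) 0 := by
    have hNd : ∀ i j, HasDerivAt (fun t => (M t)⁻¹ i j) (deriv (fun t => (M t)⁻¹ i j) 0) 0 :=
      fun i j => (differentiableAt_inv_apply (fun i j => (h 0 i j).differentiableAt)
        hdet0 i j).hasDerivAt
    intro i j
    convert hNd i j using 1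
    -- The derivative of the inverse is read off by differentiating `M * M⁻¹ = 1` entrywise at the
    -- diagonal matrix `M 0`.
    have h1 : HasDerivAt (fun t => ∑ k, M t i k * (M t)⁻¹ k j) _ 0 :=
      HasDerivAt.fun_sum fun k _ => (h 0 i k).mul (hNd k j)
    have h2 : (fun t => ∑ k, M t i k * (M t)⁻¹ k j) =ᶠ[𝓝 0] fun _ => (1 : Matrix ι ι ℝ) i j := by
      filter_upwards [hdet] with t ht
      rw [← Matrix.mul_apply, Matrix.mul_nonsing_inv _ (isUnit_iff_ne_zero.2 ht)]
    have h3 := h1.unique ((hasDerivAt_const (0 : ℝ) ((1 : Matrix ι ι ℝ) i j)).congr_of_eventuallyEq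
      h2)
    rw [hinv0, h0] at h3
    simp only [diagonal_apply, ite_mul, mul_ite, zero_mul, mul_zero, Finset.sum_add_distrib,
      Finset.sum_ite_eq, Finset.sum_ite_eq', Finset.mem_univ, if_true] at h3
    have hi := hμ i
    have hj := hμ j
    field_simp at h3 ⊢
    linarith
  refine ⟨fun t => ((M t)⁻¹ * M' t).trace, ?_, ?_, ?_⟩
  · filter_upwards [hdet] with t ht using hasDerivAt_log_det (h t) ht
  · simp [hinv0, trace, diagonal_mul, div_eq_inv_mul]
  · have h1 : HasDerivAt (fun t => ∑ i, ∑ k, (M t)⁻¹ i k * M' t k i) _ 0 :=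
      HasDerivAt.fun_sum fun i _ => HasDerivAt.fun_sum fun k _ => (hN i k).mul (h' k i)
    have h2 : (fun t => ((M t)⁻¹ * M' t).trace) = fun t => ∑ i, ∑ k, (M t)⁻¹ i k * M' t k i := by
      funext t
      simp [trace, Matrix.mul_apply]
    rw [h2]
    refine h1.congr_deriv ?_
    rw [hinv0]
    simp only [diagonal_apply, ite_mul, zero_mul, Finset.sum_add_distrib, Finset.sum_ite_eq,
      Finset.mem_univ, if_true, neg_mul, Finset.sum_neg_distrib]
    rw [sub_eq_neg_add]
    congr 1
    · congr 1
      refine Finset.sum_congr rfl fun i _ => Finset.sum_congr rfl fun j _ => ?_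
      ring
    · exact Finset.sum_congr rfl fun i _ => by rw [div_eq_inv_mul]

end LogDet

/-! ### The algebraic core at the maximum point. -/

/-- The pointwise algebra at a maximum. Here `μ` are the principal radii, `d` the gradient and `v`
the value of the support function, `S i j = T_{ijo}` and `Q i = D⁴v(e_i,e_i,e_o,e_o)`. -/
theorem eq_of_second_order_inequalities {ι : Type*} [Fintype ι] [DecidableEq ι] {o : ι}
    {v β c : ℝ} {μ d Q : ι → ℝ} {S : ι → ι → ℝ} {G : ι → ℝ}
    (hcard : 2 ≤ Fintype.card ι) (hβ : 0 < β) (hβn : β < Fintype.card ι)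
    (hc : 2 * c = 1 - β / Fintype.card ι) (hv : 0 < v) (hμ : ∀ i, 0 < μ i)
    (ho : ∀ i, μ i ≤ μ o) (hS : ∀ i j, S i j = S j i)
    (h1 : ∀ i, v * S o i = d i * (2 * c * μ i - μ o))
    (h2 : ∀ i, i ≠ o → μ i * μ o + 2 * d i * S o i + v * Q i
      - 2 * c * (μ i ^ 2 + G i - v * μ i) ≤ 0)
    (h2o : ∀ a : ι → ℝ, a o = 0 → μ o * μ o + 2 * d o * S o o + v * Q o
      - 2 * c * (μ o ^ 2 + G o - v * μ o) + 2 * v * μ o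
      + 2 * v * ∑ l, (2 * a l * S o l - a l ^ 2 * (μ o - μ l)) ≤ 0)
    (hG : ∑ i, G i / μ i = -(β * (∑ k, d k ^ 2) / v))
    (hD1 : ∑ i, S i i / μ i = -(β * d o / v))
    (hD2 : ∑ i, Q i / μ i - ∑ i, ∑ j, S i j * S j i / (μ i * μ j)
      = -(Fintype.card ι + 2 - β) - β * (μ o / v - d o ^ 2 / v ^ 2)) :
    (∀ i, μ i = μ o) ∧ ∀ i, d i = 0 := by
  classical
  set n : ℝ := (Fintype.card ι : ℝ) with hn
  have hn2 : (2 : ℝ) ≤ n := by rw [hn]; exact_mod_cast hcard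
  have hn0 : 0 < n := by linarith
  have hc0 : 0 < c := by
    have : β / n < 1 := (div_lt_one hn0).2 hβn
    linarith
  have hc1 : 0 < 1 - 2 * c := by
    rw [hc]; have := div_pos hβ hn0; linarith
  have hbn : β = n * (1 - 2 * c) := by rw [hc]; field_simp; ring
  have hμo := hμ o
  -- directions sharing the maximal eigenvalue
  have hdeg : ∀ l, l ≠ o → μ l = μ o → d l = 0 := by
    intro l hl hlo
    have hS0 : S o l = 0 := by
      by_contra hne
      set B := μ o * μ o + 2 * d o * S o o + v * Q o
        - 2 * c * (μ o ^ 2 + G o - v * μ o) + 2 * v * μ o with hB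
      -- When `μ l = μ o` the quadratic term in `a l` drops out, so the inequality is affine in `a
      -- l` and bounded above only if its slope vanishes. The value of `t` chosen below would make
      -- the left side equal to `1`.
      have key : ∀ t : ℝ, B + 2 * v * (2 * t * S o l) ≤ 0 := by
        intro t
        have := h2o (fun i => if i = l then t else 0) (by simp [hl.symm])
        simpa [hlo, mul_sub, sub_eq_add_neg, Finset.sum_add_distrib, ite_pow] using this
      have := key ((1 - B) / (4 * v * S o l))
      field_simp at this
      linarith
    have := h1 l
    rw [hS0, hlo] at this
    have h3 : d l * μ o * (1 - 2 * c) = 0 := by linarith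
    simpa [hμo.ne', hc1.ne'] using h3
  -- the optimal direction field
  set a : ι → ℝ := fun l => S o l / (μ o - μ l) with ha
  have hopt := h2o a (by simp [ha])
  -- This is the maximum over `a l` of a concave quadratic. If `μ l = μ o`, division by zero makes
  -- `a l` and both sides zero.
  have hgain : ∀ l, 2 * a l * S o l - a l ^ 2 * (μ o - μ l) = S o l ^ 2 / (μ o - μ l) := by
    intro l
    by_cases h : μ o - μ l = 0
    · simp [ha, h]
    · simp only [ha]; field_simp; ring
  simp only [hgain] at hopt
  -- sum of the second order conditions
  have hsum : ∑ i, (μ o + 2 * d i * S o i / μ i + v * (Q i / μ i)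
      - 2 * c * (μ i + G i / μ i - v)) + 2 * v
      + 2 * v / μ o * ∑ l, S o l ^ 2 / (μ o - μ l) ≤ 0 := by
    have hterm : ∀ i, μ o + 2 * d i * S o i / μ i + v * (Q i / μ i)
      - 2 * c * (μ i + G i / μ i - v) + (if i = o then 2 * v
        + 2 * v / μ o * ∑ l, S o l ^ 2 / (μ o - μ l) else 0) ≤ 0 := by
      intro i
      have hi := hμ i
      by_cases hio : i = o
      · subst hio
        rw [if_pos rfl]
        have := div_nonpos_of_nonpos_of_nonneg hopt hi.le
        refine le_trans (le_of_eq ?_) this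
        field_simp
        ring
      · rw [if_neg hio]
        have := div_nonpos_of_nonpos_of_nonneg (h2 i hio) hi.le
        refine le_trans (le_of_eq ?_) this
        field_simp
        ring
    have := Finset.sum_nonpos fun i (_ : i ∈ Finset.univ) => hterm i
    rw [Finset.sum_add_distrib, Finset.sum_ite_eq' Finset.univ o, if_pos (Finset.mem_univ o)] at this
    linarith
  -- lower bound of the third order terms
  have hSS : ∑ i, (S i i / μ i) ^ 2 + 2 * ∑ i, (if i = o then 0 else S o i ^ 2 / (μ o * μ i))
      ≤ ∑ i, ∑ j, S i j * S j i / (μ i * μ j) := by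
    have hnn : ∀ i j, 0 ≤ S i j * S j i / (μ i * μ j) := fun i j => by
      rw [hS j i]
      exact div_nonneg (mul_self_nonneg _) (mul_pos (hμ i) (hμ j)).le
    have hrow : ∀ i, (S i i / μ i) ^ 2 + (if i = o then
        ∑ j, (if j = o then 0 else S o j ^ 2 / (μ o * μ j)) else S o i ^ 2 / (μ o * μ i))
        ≤ ∑ j, S i j * S j i / (μ i * μ j) := by
      intro i
      by_cases hio : i = o
      · subst hio
        rw [if_pos rfl, ← Finset.add_sum_erase _ _ (Finset.mem_univ i),
          ← Finset.add_sum_erase _ (fun j => S i j * S j i / (μ i * μ j)) (Finset.mem_univ i)]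
        rw [if_pos rfl, zero_add, div_pow, sq, sq]
        refine add_le_add le_rfl (Finset.sum_le_sum fun j hj => ?_)
        rw [if_neg (Finset.ne_of_mem_erase hj), hS j i, sq]
      · rw [if_neg hio, ← Finset.sum_erase_add _ _ (Finset.mem_univ i), add_comm, hS o i]
        refine add_le_add ?_ (by rw [div_pow, sq, sq])
        refine le_trans (le_of_eq ?_) (Finset.single_le_sum
          (f := fun j => S i j * S j i / (μ i * μ j)) (fun j _ => hnn i j)
          (Finset.mem_erase.2 ⟨fun h => hio h.symm, Finset.mem_univ o⟩))
        rw [hS o i, sq, mul_comm (μ o)]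
    refine le_trans (le_of_eq ?_) (Finset.sum_le_sum fun i (_ : i ∈ Finset.univ) => hrow i)
    rw [Finset.sum_add_distrib, two_mul]
    congr 1
    rw [← Finset.add_sum_erase _ (fun i => if i = o then
        ∑ j, (if j = o then 0 else S o j ^ 2 / (μ o * μ j)) else S o i ^ 2 / (μ o * μ i))
        (Finset.mem_univ o), if_pos rfl]
    congr 1
    rw [← Finset.add_sum_erase _ _ (Finset.mem_univ o), if_pos rfl, zero_add]
    refine Finset.sum_congr rfl fun j hj => ?_
    rw [if_neg (Finset.ne_of_mem_erase hj), if_neg (Finset.ne_of_mem_erase hj)]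
  -- Cauchy-Schwarz, with the trace of the third derivatives known from the once differentiated
  -- equation.
  have hCS : (β * d o / v) ^ 2 / n ≤ ∑ i, (S i i / μ i) ^ 2 := by
    rw [div_le_iff₀ hn0]
    have := sq_sum_le_card_mul_sum_sq (s := Finset.univ) (f := fun i => S i i / μ i)
    rw [hD1, Finset.card_univ, ← hn] at this
    linarith [neg_sq (β * d o / v)]
  -- combine everything index by index
  have hcoef : ∀ i, i ≠ o → 2 * c * β * (d i ^ 2 / v) ≤ 2 * d i * S o i / μ i
      + 2 * v * (S o i ^ 2 / (μ o * μ i)) + 2 * v / μ o * (S o i ^ 2 / (μ o - μ i))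
      + 2 * c * β * (d i ^ 2 / v) := by
    intro i hio
    have hi := hμ i
    have hSi : S o i = d i * (2 * c * μ i - μ o) / v := by
      rw [eq_div_iff hv.ne', ← h1 i]; ring
    rcases (ho i).eq_or_lt with he | hlt
    · simp [hdeg i hio he, hSi]
    · have hs : 0 < μ o - μ i := by linarith
      -- Inserting the first order condition turns the possibly negative cross term and the two
      -- squares into a multiple of `d i ^ 2`, manifestly nonnegative because `1 - 2c = β/n > 0`.
      have e : 2 * d i * S o i / μ i + 2 * v * (S o i ^ 2 / (μ o * μ i))
          + 2 * v / μ o * (S o i ^ 2 / (μ o - μ i))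
          = 2 * d i ^ 2 / v * ((1 - 2 * c) + (1 - 2 * c) ^ 2 * μ i / (μ o - μ i)) := by
        rw [hSi]; field_simp; ring
      have : 0 ≤ 2 * d i ^ 2 / v * ((1 - 2 * c) + (1 - 2 * c) ^ 2 * μ i / (μ o - μ i)) := by
        positivity
      linarith
  have hSo : S o o = -(d o * μ o * (1 - 2 * c)) / v := by
    rw [eq_div_iff hv.ne']; linarith [h1 o]
  -- The value `2c = 1 - β/n` makes all terms proportional to `v` alone cancel and combines the
  -- radii into the differences `μ o - μ i`.
  have htot : 2 * c * ∑ i, (μ o - μ i) + 2 * c * β * ∑ i, (if i = o then 0 else d i ^ 2 / v)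
      + 2 * β * (1 - 1 / n) * (d o ^ 2 / v) ≤ 0 := by
    have hsplit : ∑ i, 2 * d i * S o i / μ i
        = 2 * d o * S o o / μ o + ∑ i, (if i = o then 0 else 2 * d i * S o i / μ i) := by
      rw [← Finset.add_sum_erase _ _ (Finset.mem_univ o),
        ← Finset.add_sum_erase _ (fun i => if i = o then (0 : ℝ) else _) (Finset.mem_univ o),
        if_pos rfl, zero_add]
      congr 1
      refine Finset.sum_congr rfl fun j hj => ?_
      rw [if_neg (Finset.ne_of_mem_erase hj)]
    have hsplit2 : ∑ i, d i ^ 2 = d o ^ 2 + v * ∑ i, (if i = o then 0 else d i ^ 2 / v) := by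
      rw [← Finset.add_sum_erase _ _ (Finset.mem_univ o),
        ← Finset.add_sum_erase _ (fun i => if i = o then (0 : ℝ) else _) (Finset.mem_univ o),
        if_pos rfl, zero_add, Finset.mul_sum]
      congr 1
      refine Finset.sum_congr rfl fun j hj => ?_
      rw [if_neg (Finset.ne_of_mem_erase hj)]
      field_simp
    have hsplit3 : ∑ l, S o l ^ 2 / (μ o - μ l)
        = ∑ i, (if i = o then 0 else S o i ^ 2 / (μ o - μ i)) := by
      refine Finset.sum_congr rfl fun j _ => ?_
      by_cases h : j = o
      · simp [h]
      · rw [if_neg h]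
    have hco := Finset.sum_le_sum fun i (_ : i ∈ Finset.univ) =>
      (show (if i = o then 0 else 2 * c * β * (d i ^ 2 / v)) ≤
        (if i = o then 0 else 2 * d i * S o i / μ i)
        + 2 * v * (if i = o then 0 else S o i ^ 2 / (μ o * μ i))
        + 2 * v / μ o * (if i = o then 0 else S o i ^ 2 / (μ o - μ i))
        + 2 * c * β * (if i = o then 0 else d i ^ 2 / v) by
        by_cases h : i = o
        · simp [h]
        · simpa [h] using hcoef i h)
    have hl : ∑ i, (if i = o then 0 else 2 * c * β * (d i ^ 2 / v))
        = 2 * c * β * ∑ i, (if i = o then 0 else d i ^ 2 / v) := by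
      rw [Finset.mul_sum]
      exact Finset.sum_congr rfl fun i _ => by split_ifs <;> simp
    rw [hl] at hco
    simp only [Finset.sum_add_distrib, ← Finset.mul_sum] at hco
    have hexp : ∑ i, (μ o + 2 * d i * S o i / μ i + v * (Q i / μ i)
      - 2 * c * (μ i + G i / μ i - v)) = n * μ o + ∑ i, 2 * d i * S o i / μ i
        + v * ∑ i, Q i / μ i - 2 * c * (∑ i, μ i + ∑ i, G i / μ i - n * v) := by
      simp only [Finset.sum_sub_distrib, Finset.sum_add_distrib, ← Finset.mul_sum,
        Finset.sum_const, Finset.card_univ, nsmul_eq_mul, hn]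
    rw [hexp, hsplit, hG, hsplit2, hsplit3] at hsum
    have hQ : ∑ i, Q i / μ i = ∑ i, ∑ j, S i j * S j i / (μ i * μ j)
      -(n + 2 - β) - β * (μ o / v - d o ^ 2 / v ^ 2) := by linarith
    rw [hQ] at hsum
    have hvSS := mul_le_mul_of_nonneg_left (le_trans (add_le_add_left hCS _) hSS) hv.le
    have hμs : ∑ i, (μ o - μ i) = n * μ o - ∑ i, μ i := by
      simp [Finset.sum_sub_distrib, hn]
    rw [hμs]
    set X1 := ∑ i, (if i = o then 0 else 2 * d i * S o i / μ i)
    set X2 := ∑ i, (if i = o then 0 else S o i ^ 2 / (μ o * μ i))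
    set X3 := ∑ i, (if i = o then 0 else S o i ^ 2 / (μ o - μ i))
    set X4 := ∑ i, (if i = o then 0 else d i ^ 2 / v)
    set X5 := ∑ i, ∑ j, S i j * S j i / (μ i * μ j)
    set X6 := ∑ i, μ i
    have e1 : 2 * d o * S o o / μ o = -(2 * (d o ^ 2 / v) * (1 - 2 * c)) := by
      rw [hSo]; field_simp
    have e2 : v * ((β * d o / v) ^ 2 / n) = (β ^ 2 / n) * (d o ^ 2 / v) := by
      field_simp
    have e3 : β * (d o ^ 2 + v * X4) / v = β * (d o ^ 2 / v) + β * X4 := by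
      field_simp
    have e4 : v * (X5 - (n + 2 - β) - β * (μ o / v - d o ^ 2 / v ^ 2))
        = v * X5 - v * (n + 2 - β) - β * μ o + β * (d o ^ 2 / v) := by
      field_simp
      ring
    rw [e1, e3, e4] at hsum
    rw [mul_add, e2] at hvSS
    set D := d o ^ 2 / v
    have e5 : β / n = 1 - 2 * c := by linarith
    have e6 : β ^ 2 / n = β * (1 - 2 * c) := by rw [← e5]; ring
    have e7 : 2 * β * (1 - 1 / n) = 2 * β - 2 * (1 - 2 * c) := by rw [← e5]; ring
    rw [e6] at hvSS
    rw [e7]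
    have e8 : 2 * c * n = n - β := by rw [hbn]; ring
    have e9 : 2 * c * (X6 + -(β * D + β * X4) - n * v) = 2 * c * X6 - 2 * c * β * D
      - 2 * c * β * X4 - (n - β) * v := by rw [← e8]; ring
    have e10 : 2 * c * (n * μ o - X6) = (n - β) * μ o - 2 * c * X6 := by rw [← e8]; ring
    rw [e9] at hsum
    rw [e10]
    linarith
  have hA : 0 ≤ ∑ i, (μ o - μ i) := Finset.sum_nonneg fun i _ => by linarith [ho i]
  have hB : ∀ i ∈ Finset.univ, 0 ≤ (if i = o then 0 else d i ^ 2 / v) := fun i _ => by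
    split_ifs <;> positivity
  have hB' := Finset.sum_nonneg hB
  have hC : 0 < 1 - 1 / n := by
    have : 1 / n ≤ 1 / 2 := one_div_le_one_div_of_le (by norm_num) hn2
    linarith
  have hD : 0 ≤ d o ^ 2 / v := by positivity
  have tA := mul_nonneg hc0.le hA
  have tB := mul_nonneg (mul_nonneg hc0.le hβ.le) hB'
  have tC := mul_nonneg (mul_nonneg hβ.le hC.le) hD
  have zA : ∑ i, (μ o - μ i) = 0 := by
    have : c * ∑ i, (μ o - μ i) = 0 := by linarith
    simpa [hc0.ne'] using this
  have zB : d o ^ 2 / v = 0 := by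
    have : β * (1 - 1 / n) * (d o ^ 2 / v) = 0 := by linarith
    rcases mul_eq_zero.1 this with h | h
    · exact absurd h (mul_pos hβ hC).ne'
    · exact h
  have hall : ∀ i, μ i = μ o := fun i => by
    have := (Finset.sum_eq_zero_iff_of_nonneg fun i _ => by linarith [ho i]).1 zA i
      (Finset.mem_univ i)
    linarith
  refine ⟨hall, fun i => ?_⟩
  by_cases hio : i = o
  · subst hio
    simpa [hv.ne'] using zB
  · exact hdeg i hio (hall i)

/-! ### Iterated directional derivatives. -/

section DirDeriv

variable {V : Type*} [NormedAddCommGroup V] [NormedSpace ℝ V]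

/-- The derivative of a function in a fixed direction. -/
noncomputable def dirDeriv (a : V) (g : V → ℝ) : V → ℝ := fun x => fderiv ℝ g x a

theorem contDiff_dirDeriv {g : V → ℝ} {k m : ℕ∞ω} (hg : ContDiff ℝ k g) (a : V)
    (hm : m + 1 ≤ k := by norm_num) : ContDiff ℝ m (dirDeriv a g) :=
  (hg.fderiv_right hm).clm_apply contDiff_const

theorem hasDerivAt_line {g : V → ℝ} {k : ℕ∞ω} (hg : ContDiff ℝ k g) (a : V) (t : ℝ)
    (hk : k ≠ 0 := by norm_num) :
    HasDerivAt (fun s : ℝ => g (s • a)) (dirDeriv a g (t • a)) t := by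
  have h1 : HasDerivAt (fun s : ℝ => s • a) a t := by
    simpa using (hasDerivAt_id t).smul_const a
  exact ((hg.differentiable hk) (t • a)).hasFDerivAt.comp_hasDerivAt t h1

theorem fderiv_fderiv_apply {g : V → ℝ} {k : ℕ∞ω} (hg : ContDiff ℝ k g) (x a b : V)
    (hk : 2 ≤ k := by norm_num) :
    fderiv ℝ (fderiv ℝ g) x a b = dirDeriv a (dirDeriv b g) x := by
  have h := ((hg.fderiv_right (m := 1) hk).differentiable (by simp)) x
  unfold dirDeriv
  rw [fderiv_clm_apply h (by fun_prop)]
  simp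

theorem dirDeriv_comm {g : V → ℝ} {k : ℕ∞ω} (hg : ContDiff ℝ k g) (a b : V)
    (hk : 2 ≤ k := by norm_num) :
    dirDeriv a (dirDeriv b g) = dirDeriv b (dirDeriv a g) := by
  funext x
  rw [← fderiv_fderiv_apply hg x a b hk, ← fderiv_fderiv_apply hg x b a hk]
  exact (hg.contDiffAt.isSymmSndFDerivAt (by simpa using hk)) a b

theorem dirDeriv_sum {κ : Type*} (s : Finset κ) (a : κ → ℝ) (e : κ → V) (g : V → ℝ) (x : V) :
    dirDeriv (∑ l ∈ s, a l • e l) g x = ∑ l ∈ s, a l * dirDeriv (e l) g x := by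
  simp [dirDeriv]

end DirDeriv

/-! ### The maximum principle for a globally smooth support function. -/

section Support

variable {V : Type*} [NormedAddCommGroup V] [InnerProductSpace ℝ V]
  {ι : Type*} [Fintype ι]

/-- Derivatives of `|Dv|² + (v - z·Dv)²` along a line through the origin. -/
theorem hasDerivAt_position_sq (b : OrthonormalBasis ι ℝ V) {v : V → ℝ} (hv : ContDiff ℝ 4 v)
    (W c : ℝ) (e : V) :
    ∃ A₁ : ℝ → ℝ, (∀ t, HasDerivAt (fun s : ℝ => W + c * (∑ k, dirDeriv (b k) v (s • e) ^ 2 +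
        (v (s • e) - fderiv ℝ v (s • e) (s • e)) ^ 2)) (A₁ t) t) ∧
      A₁ 0 = 2 * c * ∑ k, dirDeriv (b k) v 0 * dirDeriv e (dirDeriv (b k) v) 0 ∧
      HasDerivAt A₁ (2 * c * (∑ k, (dirDeriv e (dirDeriv (b k) v) 0 ^ 2
        + dirDeriv (b k) v 0 * dirDeriv e (dirDeriv e (dirDeriv (b k) v)) 0)
        - v 0 * dirDeriv e (dirDeriv e v) 0)) 0 := by
  have ht : ∀ t : ℝ, HasDerivAt (fun t : ℝ => t) 1 t := fun t => hasDerivAt_id t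
  have hk : ∀ k, ContDiff ℝ 3 (dirDeriv (b k) v) := fun k => contDiff_dirDeriv hv (b k)
  have hke : ∀ k, ContDiff ℝ 2 (dirDeriv e (dirDeriv (b k) v)) := fun k =>
    contDiff_dirDeriv (hk k) e
  have he : ContDiff ℝ 3 (dirDeriv e v) := contDiff_dirDeriv hv e
  have hee : ContDiff ℝ 2 (dirDeriv e (dirDeriv e v)) := contDiff_dirDeriv he e
  -- At `z = s • e` the radial term `z·Dv` is `s ∂_e v`, so the derivative of `v - z·Dv` is `-s ∂_e
  -- ∂_e v`, which vanishes at `0`.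
  have e0 : (fun s : ℝ => W + c * (∑ k, dirDeriv (b k) v (s • e) ^ 2 +
        (v (s • e) - fderiv ℝ v (s • e) (s • e)) ^ 2)) =
      fun s : ℝ => W + c * (∑ k, dirDeriv (b k) v (s • e) ^ 2 +
        (v (s • e) - s * dirDeriv e v (s • e)) ^ 2) := by
    funext s
    simp [dirDeriv]
  rw [e0]
  refine ⟨fun t => c * (∑ k, 2 * (dirDeriv (b k) v (t • e) * dirDeriv e (dirDeriv (b k) v) (t • e))
    + -2 * t * ((v (t • e) - t * dirDeriv e v (t • e)) * dirDeriv e (dirDeriv e v) (t • e))),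
    ?_, ?_, ?_⟩
  · intro t
    have h1 : HasDerivAt (fun s : ℝ => ∑ k, dirDeriv (b k) v (s • e) ^ 2) _ t :=
      HasDerivAt.fun_sum fun k _ => (hasDerivAt_line (hk k) e t).pow 2
    refine (((h1.add (((hasDerivAt_line hv e t).sub ((ht t).mul
      (hasDerivAt_line he e t))).pow 2)).const_mul c).const_add W).congr_deriv ?_
    congr 1
    congr 1
    · exact Finset.sum_congr rfl fun k _ => by ring
    · simp only [Pi.sub_apply, Pi.mul_apply]
      ring
  · simp only [zero_smul, mul_zero, zero_mul, add_zero, ← Finset.mul_sum]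
    ring
  · have h1 : HasDerivAt (fun t : ℝ => ∑ k, 2 * (dirDeriv (b k) v (t • e) *
        dirDeriv e (dirDeriv (b k) v) (t • e))) _ 0 :=
      HasDerivAt.fun_sum fun k _ => ((hasDerivAt_line (hk k) e 0).mul
        (hasDerivAt_line (hke k) e 0)).const_mul 2
    refine ((h1.add (((ht 0).const_mul (-2)).mul
      (((hasDerivAt_line hv e 0).sub ((ht 0).mul (hasDerivAt_line he e 0))).mul
        (hasDerivAt_line hee e 0)))).const_mul c).congr_deriv ?_
    simp only [Pi.sub_apply, Pi.mul_apply, zero_smul, ← Finset.mul_sum]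
    rw [Finset.sum_congr rfl fun k _ => by rw [← sq]]
    ring

/-- This turns the logarithmic equation into identities at the origin. The equation holds on a
neighbourhood, so the first derivatives of both sides agree there and may be differentiated again.
-/
theorem hasDerivAt_log_rhs {p p₁ : ℝ → ℝ} {p₂ γ β : ℝ} (hp : ∀ t, HasDerivAt p (p₁ t) t)
    (hp₁ : HasDerivAt p₁ p₂ 0) (h0 : 0 < p 0) {ℓ L : ℝ → ℝ} {d : ℝ}
    (hℓ : ∀ᶠ t in 𝓝 0, HasDerivAt ℓ (L t) t) (hL : HasDerivAt L d 0)
    (heq : ∀ᶠ t in 𝓝 0, ℓ t = -γ * Real.log (1 + t ^ 2) - β * Real.log (p t)) :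
    L 0 = -(β * p₁ 0 / p 0) ∧ d = -(2 * γ) - β * (p₂ / p 0 - p₁ 0 ^ 2 / p 0 ^ 2) := by
  have ht : ∀ t : ℝ, HasDerivAt (fun t : ℝ => t) 1 t := fun t => hasDerivAt_id t
  have hpos : ∀ᶠ t in 𝓝 0, 0 < p t := (hp 0).continuousAt.eventually (lt_mem_nhds h0)
  have hR : ∀ᶠ t in 𝓝 0, L t = -γ * (2 * t / (1 + t ^ 2)) - β * (p₁ t / p t) := by
    filter_upwards [hℓ, hpos, heq.eventually_nhds] with t h1 h2 h3
    have h4 : HasDerivAt (fun t : ℝ => -γ * Real.log (1 + t ^ 2) - β * Real.log (p t))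
        (-γ * (2 * t / (1 + t ^ 2)) - β * (p₁ t / p t)) t := by
      refine (((((ht t).pow 2).const_add 1).log (by simp only [Pi.pow_apply]; positivity)).const_mul
        (-γ) |>.sub (((hp t).log h2.ne').const_mul β)).congr_deriv ?_
      simp
    exact h1.unique (h4.congr_of_eventuallyEq h3)
  constructor
  · rw [hR.self_of_nhds]
    simp [mul_div_assoc]
  · have h5 : HasDerivAt (fun t => -γ * (2 * t / (1 + t ^ 2)) - β * (p₁ t / p t)) _ 0 :=
      ((((ht 0).const_mul 2).div (((ht 0).pow 2).const_add 1) (by simp)).const_mul (-γ)).sub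
        ((hp₁.div (hp 0) h0.ne').const_mul β)
    rw [hL.unique (h5.congr_of_eventuallyEq hR)]
    simp
    field_simp

variable [DecidableEq ι]

/-- A support function `v` satisfying the self-similar equation, for which the maximum of
`v λ_min⁻¹ - c |F|²` is attained at the origin, is umbilic there with vanishing gradient. -/
theorem umbilic_of_support_function (b : OrthonormalBasis ι ℝ V)
    (hcard : 2 ≤ Fintype.card ι) {v : V → ℝ} (hv : ContDiff ℝ 4 v) {β c W : ℝ} (hβ : 0 < β)
    (hβn : β < Fintype.card ι) (hc : 2 * c = 1 - β / Fintype.card ι) {μ : ι → ℝ}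
    (hμ : ∀ i, 0 < μ i)
    (hdiag : ∀ i j, fderiv ℝ (fderiv ℝ v) 0 (b i) (b j) = if i = j then μ i else 0)
    {o : ι} (ho : ∀ i, μ i ≤ μ o) (hv0 : 0 < v 0)
    (hpde : ∀ᶠ z in 𝓝 (0 : V),
      Real.log (of fun i j => fderiv ℝ (fderiv ℝ v) z (b i) (b j)).det =
        -((Fintype.card ι + 2 - β) / 2) * Real.log (1 + ‖z‖ ^ 2) - β * Real.log (v z))
    (hW : ∀ᶠ z in 𝓝 (0 : V), ∀ (ξ : V) (t : ℝ), v z * fderiv ℝ (fderiv ℝ v) z ξ ξ ≤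
      (W + c * (∑ k, fderiv ℝ v z (b k) ^ 2 + (v z - fderiv ℝ v z z) ^ 2)) *
        (‖ξ + t • z‖ ^ 2 + t ^ 2))
    (heq : v 0 * μ o = W + c * (∑ k, fderiv ℝ v 0 (b k) ^ 2 + v 0 ^ 2)) :
    (∀ i, μ i = μ o) ∧ ∀ k, fderiv ℝ v 0 (b k) = 0 := by
  have hD : ∀ i j, dirDeriv (b i) (dirDeriv (b j) v) 0 = if i = j then μ i else 0 := fun i j => by
    rw [← fderiv_fderiv_apply hv, hdiag]
  have hk : ∀ k, ContDiff ℝ 3 (dirDeriv (b k) v) := fun k => contDiff_dirDeriv hv (b k)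
  have hkl : ∀ k l, ContDiff ℝ 2 (dirDeriv (b l) (dirDeriv (b k) v)) := fun k l =>
    contDiff_dirDeriv (hk k) (b l)
  have hklm : ∀ k l m, ContDiff ℝ 1 (dirDeriv (b m) (dirDeriv (b l) (dirDeriv (b k) v))) :=
    fun k l m => contDiff_dirDeriv (hkl k l) (b m)
  have hline : ∀ i, Tendsto (fun s : ℝ => s • b i) (𝓝 0) (𝓝 (0 : V)) := fun i => by
    have : Continuous fun s : ℝ => s • b i := by fun_prop
    simpa using this.tendsto 0
  have hnorm : ∀ (i : ι) (s : ℝ), ‖s • b i‖ ^ 2 = s ^ 2 := fun i s => by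
    rw [norm_smul, b.norm_eq_one, mul_one, Real.norm_eq_abs, sq_abs]
  set d : ι → ℝ := fun k => dirDeriv (b k) v 0 with hd
  set S : ι → ι → ℝ := fun i j => dirDeriv (b o) (dirDeriv (b i) (dirDeriv (b j) v)) 0 with hS
  set Q : ι → ℝ := fun i =>
    dirDeriv (b i) (dirDeriv (b i) (dirDeriv (b o) (dirDeriv (b o) v))) 0 with hQ
  set G : ι → ℝ := fun i =>
    ∑ k, d k * dirDeriv (b i) (dirDeriv (b i) (dirDeriv (b k) v)) 0 with hG
  -- the differentiated equation
  have hlog : ∀ k, ∑ i, dirDeriv (b k) (dirDeriv (b i) (dirDeriv (b i) v)) 0 / μ i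
        = -(β * d k / v 0) ∧
      ∑ i, dirDeriv (b k) (dirDeriv (b k) (dirDeriv (b i) (dirDeriv (b i) v))) 0 / μ i
        - ∑ i, ∑ j, dirDeriv (b k) (dirDeriv (b i) (dirDeriv (b j) v)) 0
          * dirDeriv (b k) (dirDeriv (b j) (dirDeriv (b i) v)) 0 / (μ i * μ j)
        = -(Fintype.card ι + 2 - β) - β * (μ k / v 0 - d k ^ 2 / v 0 ^ 2) := by
    intro k
    obtain ⟨L, h1, h2, h3⟩ := hasDerivAt_log_det_diagonal
      (M := fun s => of fun i j => dirDeriv (b i) (dirDeriv (b j) v) (s • b k))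
      (M' := fun s => of fun i j => dirDeriv (b k) (dirDeriv (b i) (dirDeriv (b j) v)) (s • b k))
      (M'' := of fun i j => dirDeriv (b k) (dirDeriv (b k) (dirDeriv (b i) (dirDeriv (b j) v))) 0)
      (μ := μ) (fun t i j => by simpa using hasDerivAt_line (hkl j i) (b k) t)
      (fun i j => by simpa using hasDerivAt_line (hklm j i k) (b k) 0)
      (by ext i j; simp [hD, diagonal_apply]) (fun i => (hμ i).ne')
    obtain ⟨h4, h5⟩ := hasDerivAt_log_rhs (γ := (Fintype.card ι + 2 - β) / 2) (β := β)
      (hasDerivAt_line hv (b k)) (hasDerivAt_line (hk k) (b k) 0) (by simpa using hv0) h1 h3 (by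
        filter_upwards [(hline k).eventually hpde] with s hs
        rw [hnorm] at hs
        rw [← hs]
        simp only [fderiv_fderiv_apply hv])
    simp only [zero_smul, of_apply] at h2 h4 h5
    constructor
    · rw [← h2, h4]
    · rw [h5, hD, if_pos rfl]
      ring
  -- the second derivative test
  have hquad : ∀ i (κ ε : ℝ) (a : V), (∀ᶠ s in 𝓝 (0 : ℝ),
      v (s • b i) * fderiv ℝ (fderiv ℝ v) (s • b i) (b o + s • a) (b o + s • a) ≤
      (W + c * (∑ k, dirDeriv (b k) v (s • b i) ^ 2 +
        (v (s • b i) - fderiv ℝ v (s • b i) (s • b i)) ^ 2)) * (1 + κ * s ^ 2 + ε * s ^ 4)) →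
      d i * μ o + v 0 * S o i + 2 * v 0 * dirDeriv (b o) (dirDeriv a v) 0 = 2 * c * (d i * μ i) ∧
      μ i * μ o + 2 * d i * S o i + v 0 * Q i + 4 * (d i * dirDeriv (b o) (dirDeriv a v) 0
        + v 0 * dirDeriv (b i) (dirDeriv (b o) (dirDeriv a v)) 0)
        + 2 * v 0 * dirDeriv a (dirDeriv a v) 0
        ≤ 2 * c * (μ i ^ 2 + G i - v 0 * μ i) + 2 * κ * (v 0 * μ o) := by
    intro i κ ε a ha
    have hka : ContDiff ℝ 3 (dirDeriv a v) := contDiff_dirDeriv hv a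
    have hkaa : ContDiff ℝ 2 (dirDeriv a (dirDeriv a v)) := contDiff_dirDeriv hka a
    have hkoa : ContDiff ℝ 2 (dirDeriv (b o) (dirDeriv a v)) := contDiff_dirDeriv hka (b o)
    have hkioa : ContDiff ℝ 1 (dirDeriv (b i) (dirDeriv (b o) (dirDeriv a v))) :=
      contDiff_dirDeriv hkoa (b i)
    have hkiaa : ContDiff ℝ 1 (dirDeriv (b i) (dirDeriv a (dirDeriv a v))) :=
      contDiff_dirDeriv hkaa (b i)
    obtain ⟨A₁, hA, hA0, hA₁⟩ := hasDerivAt_position_sq b hv W c (b i)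
    have hS' : dirDeriv (b i) (dirDeriv (b o) (dirDeriv (b o) v)) 0 = S o i := by
      rw [dirDeriv_comm (hk o), dirDeriv_comm hv (b i)]
    obtain ⟨e1, e2⟩ := second_deriv_test_of_quadratic_frame (κ := κ) (ε := ε)
      (hasDerivAt_line hv (b i)) (hasDerivAt_line (hk i) (b i) 0)
      (hasDerivAt_line (hkl o o) (b i)) (hasDerivAt_line (hklm o o i) (b i) 0)
      (hasDerivAt_line hkoa (b i)) (hasDerivAt_line hkioa (b i) 0)
      (hasDerivAt_line hkaa (b i))
      (hasDerivAt_line hkiaa (b i) 0).continuousAt hA hA₁ (by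
        filter_upwards [ha] with s hs
        refine le_trans (le_of_eq ?_) hs
        simp only [map_add, map_smul, _root_.add_apply, _root_.smul_apply, smul_eq_mul,
          fderiv_fderiv_apply hv]
        rw [dirDeriv_comm hv a (b o)]
        ring) (by
        simp only [zero_smul, hD, if_true]
        rw [heq]
        simp [dirDeriv])
    rw [hA0] at e1
    simp only [zero_smul, hD, if_true, hS'] at e1 e2
    have hsum : ∑ k, d k * (if i = k then μ i else 0) = d i * μ i := by simp
    have hsum2 : ∑ k, ((if i = k then μ i else 0) ^ 2 + d k *
        dirDeriv (b i) (dirDeriv (b i) (dirDeriv (b k) v)) 0) = μ i ^ 2 + G i := by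
      rw [Finset.sum_add_distrib]
      simp [ite_pow, hG]
    have hA00 : W + c * (∑ k, dirDeriv (b k) v 0 ^ 2 + (v 0 - fderiv ℝ v 0 0) ^ 2) = v 0 * μ o := by
      rw [heq]; simp [dirDeriv]
    rw [hsum2, hA00] at e2
    rw [hsum] at e1
    constructor
    · linarith
    · linarith
  refine eq_of_second_order_inequalities (v := v 0) (β := β) (c := c) (d := d) (Q := Q) (S := S)
    (G := G) hcard hβ hβn hc hv0 hμ ho ?_ ?_ ?_ ?_ ?_ ?_ ?_
  · intro i j
    simp only [hS]
    rw [dirDeriv_comm hv]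
  · intro i
    have h := (hquad i 0 0 0 (by
      filter_upwards [(hline i).eventually hW] with s hs
      simpa [dirDeriv] using hs (b o) 0)).1
    have h0 : dirDeriv (0 : V) v = 0 := by funext x; simp [dirDeriv]
    have h1 : ∀ x, dirDeriv x (0 : V → ℝ) = 0 := by intro x; funext y; simp [dirDeriv]
    rw [h0, h1] at h
    simp only [Pi.zero_apply] at h
    linarith
  · intro i hio
    have h := (hquad i 0 0 0 (by
      filter_upwards [(hline i).eventually hW] with s hs
      simpa [dirDeriv] using hs (b o) 0)).2
    have h0 : dirDeriv (0 : V) v = 0 := by funext x; simp [dirDeriv]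
    have h1 : ∀ x, dirDeriv x (0 : V → ℝ) = 0 := by intro x; funext y; simp [dirDeriv]
    rw [h0, h1, h1, h1] at h
    simp only [Pi.zero_apply] at h
    linarith
  · intro a hao
    have hav : ‖∑ l, a l • b l‖ ^ 2 = ∑ l, a l ^ 2 := by
      rw [← real_inner_self_eq_norm_sq, b.orthonormal.inner_sum]
      exact Finset.sum_congr rfl fun i _ => by simp [sq]
    have hio : inner ℝ (b o) (∑ l, a l • b l) = 0 := by
      rw [b.orthonormal.inner_right_fintype, hao]
    -- For `z = s b_o` and `ξ = b_o + s a` with `a ⊥ b_o`, the choice `t = -s` minimizes the second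
    -- order part of the right side. It gives `(1-s²)² + s²|a|² + s² = 1 + (|a|²-1)s² + s⁴`, hence
    -- the two constants. In the other directions `a = 0` and `t = 0` suffice.
    have h := (hquad o (∑ l, a l ^ 2 - 1) 1 (∑ l, a l • b l) (by
      filter_upwards [(hline o).eventually hW] with s hs
      refine (hs (b o + s • ∑ l, a l • b l) (-s)).trans (le_of_eq ?_)
      congr 1
      have e : b o + s • ∑ l, a l • b l + -s • s • b o
          = (1 - s ^ 2) • b o + s • ∑ l, a l • b l := by
        module
      rw [e, norm_add_sq_real, inner_smul_left, inner_smul_right, hio, norm_smul, norm_smul,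
        b.norm_eq_one, mul_pow, mul_pow, hav]
      simp only [Real.norm_eq_abs, sq_abs]
      simp
      ring)).2
    have r0 : dirDeriv (b o) (dirDeriv (∑ l, a l • b l) v) 0 = 0 := by
      rw [dirDeriv_comm hv, dirDeriv_sum]
      simp [hD, hao]
    have r1 : dirDeriv (b o) (dirDeriv (b o) (dirDeriv (∑ l, a l • b l) v)) 0
        = ∑ l, a l * S o l := by
      rw [dirDeriv_comm hv, dirDeriv_comm (hk o), dirDeriv_sum]
      refine Finset.sum_congr rfl fun l _ => ?_
      rw [dirDeriv_comm (hk o), dirDeriv_comm hv (b l)]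
    have w0 : dirDeriv (∑ l, a l • b l) (dirDeriv (∑ l, a l • b l) v) 0
        = ∑ l, a l ^ 2 * μ l := by
      rw [dirDeriv_sum]
      refine Finset.sum_congr rfl fun l _ => ?_
      rw [dirDeriv_comm hv, dirDeriv_sum]
      simp [hD, sq, mul_assoc]
    rw [r0, r1, w0] at h
    have hx : ∑ l, (2 * a l * S o l - a l ^ 2 * (μ o - μ l))
        = 2 * ∑ l, a l * S o l - (∑ l, a l ^ 2) * μ o + ∑ l, a l ^ 2 * μ l := by
      rw [Finset.mul_sum, Finset.sum_mul, ← Finset.sum_sub_distrib, ← Finset.sum_add_distrib]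
      exact Finset.sum_congr rfl fun l _ => by ring
    rw [hx]
    linarith
  -- Commuting derivatives turns the trace of `G` into the `d`-weighted sum of the first derivatives
  -- of `log det D²v`, which the equation determines.
  · have h1 : ∀ i, G i / μ i
        = ∑ k, d k * (dirDeriv (b k) (dirDeriv (b i) (dirDeriv (b i) v)) 0 / μ i) := by
      intro i
      simp only [hG]
      rw [Finset.sum_div]
      refine Finset.sum_congr rfl fun k _ => ?_
      rw [mul_div_assoc, dirDeriv_comm hv (b i) (b k), dirDeriv_comm (hk i) (b i) (b k)]
    rw [Finset.sum_congr rfl fun i _ => h1 i, Finset.sum_comm]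
    simp only [← Finset.mul_sum, (hlog _).1]
    rw [Finset.mul_sum, Finset.sum_div, ← Finset.sum_neg_distrib]
    exact Finset.sum_congr rfl fun k _ => by ring
  · exact (hlog o).1
  · rw [← (hlog o).2]
    congr 1
    refine Finset.sum_congr rfl fun i _ => ?_
    simp only [hQ]
    congr 1
    rw [dirDeriv_comm (hk o) (b i) (b o), dirDeriv_comm hv (b i) (b o),
      dirDeriv_comm (hkl i o) (b i) (b o), dirDeriv_comm (hk i) (b i) (b o)]

end Support

/-! ### Passage to germs and to an eigenframe of the Hessian. -/

section LocalSupport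

/-- A germ of a smooth function extends to a global smooth function. -/
theorem exists_contDiff_eventuallyEq {V : Type*} [NormedAddCommGroup V] [NormedSpace ℝ V]
    [HasContDiffBump V] {m : ℕ} {g : V → ℝ} {x : V} (hg : ContDiffAt ℝ m g x) :
    ∃ h : V → ℝ, ContDiff ℝ m h ∧ h =ᶠ[𝓝 x] g := by
  obtain ⟨u, hu, hgu⟩ := hg.contDiffOn (m := m) le_rfl (by simp)
  obtain ⟨ε, hε, hball⟩ := Metric.mem_nhds_iff.1 hu
  let χ : ContDiffBump x := ⟨ε / 4, ε / 2, by positivity, by linarith⟩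
  refine ⟨fun y => χ y * g y, ?_, ?_⟩
  · rw [contDiff_iff_contDiffAt]
    intro y
    by_cases hy : y ∈ Metric.ball x ε
    · exact χ.contDiffAt.mul ((hgu.mono hball).contDiffAt (Metric.isOpen_ball.mem_nhds hy))
    · have : (fun y => χ y * g y) =ᶠ[𝓝 y] fun _ => 0 := by
        have h1 : (Metric.closedBall x (ε / 2))ᶜ ∈ 𝓝 y := by
          refine Metric.isClosed_closedBall.isOpen_compl.mem_nhds ?_
          simp only [Set.mem_compl_iff, Metric.mem_closedBall, not_le]
          simp only [Metric.mem_ball, not_lt] at hy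
          linarith
        filter_upwards [h1] with z hz
        simp only [Set.mem_compl_iff, Metric.mem_closedBall, not_le] at hz
        rw [χ.zero_of_le_dist hz.le, zero_mul]
      exact contDiffAt_const.congr_of_eventuallyEq this
  · filter_upwards [χ.eventuallyEq_one] with y hy
    simp [hy]

variable {V : Type*} [NormedAddCommGroup V] [InnerProductSpace ℝ V] [FiniteDimensional ℝ V]
  {ι κ : Type*} [Fintype ι] [Fintype κ]

/-- The endomorphism representing a bilinear form. -/
noncomputable def bilinEnd (B : V →L[ℝ] V →L[ℝ] ℝ) : V →ₗ[ℝ] V :=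
  haveI := FiniteDimensional.complete ℝ V
  { toFun := fun ξ => (InnerProductSpace.toDual ℝ V).symm (B ξ)
    map_add' := by simp
    map_smul' := by simp }

theorem inner_bilinEnd (B : V →L[ℝ] V →L[ℝ] ℝ) (ξ η : V) : inner ℝ (bilinEnd B ξ) η = B ξ η :=
  haveI := FiniteDimensional.complete ℝ V
  InnerProductSpace.toDual_symm_apply

theorem sum_sq_apply_orthonormalBasis (L : V →L[ℝ] ℝ) (b : OrthonormalBasis ι ℝ V)
    (b' : OrthonormalBasis κ ℝ V) : ∑ k, L (b k) ^ 2 = ∑ k, L (b' k) ^ 2 := by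
  have := FiniteDimensional.complete ℝ V
  have h : ∀ x, L x = inner ℝ x ((InnerProductSpace.toDual ℝ V).symm L) := fun x => by
    rw [real_inner_comm, InnerProductSpace.toDual_symm_apply]
  simp only [h, OrthonormalBasis.sum_sq_inner_right]

variable [DecidableEq ι]

/-- The determinant is that of a frame-independent endomorphism, so the equation survives the change
to an eigenbasis of the Hessian. -/
theorem det_bilin_orthonormalBasis (B : V →L[ℝ] V →L[ℝ] ℝ) (b : OrthonormalBasis ι ℝ V) :
    (of fun i j => B (b i) (b j)).det = LinearMap.det (bilinEnd B) := by
  rw [← LinearMap.det_toMatrix b.toBasis, ← det_transpose]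
  congr 1
  ext i j
  rw [transpose_apply, of_apply, LinearMap.toMatrix_apply, b.coe_toBasis_repr_apply,
    b.repr_apply_apply, real_inner_comm, b.coe_toBasis, inner_bilinEnd]

/-- Local form of `umbilic_of_support_function`, in an arbitrary orthonormal frame. -/
theorem umbilic_of_local_support_function (b : OrthonormalBasis ι ℝ V)
    (hcard : 2 ≤ Fintype.card ι) {v : V → ℝ} (hv : ContDiffAt ℝ 4 v 0) {β c W : ℝ} (hβ : 0 < β)
    (hβn : β < Fintype.card ι) (hc : 2 * c = 1 - β / Fintype.card ι)
    (hpos : ∀ ξ, ξ ≠ 0 → 0 < fderiv ℝ (fderiv ℝ v) 0 ξ ξ) (hv0 : 0 < v 0)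
    (hpde : ∀ᶠ z in 𝓝 (0 : V),
      Real.log (of fun i j => fderiv ℝ (fderiv ℝ v) z (b i) (b j)).det =
        -((Fintype.card ι + 2 - β) / 2) * Real.log (1 + ‖z‖ ^ 2) - β * Real.log (v z))
    (hW : ∀ᶠ z in 𝓝 (0 : V), ∀ (ξ : V) (t : ℝ), v z * fderiv ℝ (fderiv ℝ v) z ξ ξ ≤
      (W + c * (∑ k, fderiv ℝ v z (b k) ^ 2 + (v z - fderiv ℝ v z z) ^ 2)) *
        (‖ξ + t • z‖ ^ 2 + t ^ 2))
    {ξ₀ : V} (hξ₀ : ‖ξ₀‖ = 1) (heq : v 0 * fderiv ℝ (fderiv ℝ v) 0 ξ₀ ξ₀ =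
      W + c * (∑ k, fderiv ℝ v 0 (b k) ^ 2 + v 0 ^ 2)) :
    (∃ m : ℝ, ∀ ξ η, fderiv ℝ (fderiv ℝ v) 0 ξ η = m * inner ℝ ξ η) ∧ fderiv ℝ v 0 = 0 := by
  -- All hypotheses and conclusions depend only on the germ at `0`, so `v` may be replaced by a
  -- global `C⁴` function.
  obtain ⟨g, hg, hgv⟩ := exists_contDiff_eventuallyEq (m := 4) hv
  have e0 : g 0 = v 0 := hgv.self_of_nhds
  have e1 : fderiv ℝ g =ᶠ[𝓝 0] fderiv ℝ v := hgv.fderiv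
  have e2 : fderiv ℝ (fderiv ℝ g) =ᶠ[𝓝 0] fderiv ℝ (fderiv ℝ v) := e1.fderiv
  have e10 := e1.self_of_nhds
  have e20 := e2.self_of_nhds
  rw [← e20] at hpos heq
  simp only [← e20]
  rw [← e10, ← e0] at heq
  rw [← e10]
  rw [← e0] at hv0
  set B := fderiv ℝ (fderiv ℝ g) 0 with hB
  have hg4 : ContDiff ℝ 4 g := by exact_mod_cast hg
  have hsymm : (bilinEnd B).IsSymmetric := fun x y => by
    rw [inner_bilinEnd, real_inner_comm, inner_bilinEnd, hB, fderiv_fderiv_apply hg4,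
      fderiv_fderiv_apply hg4, dirDeriv_comm hg4]
  have hdim : Module.finrank ℝ V = Fintype.card ι := Module.finrank_eq_card_basis b.toBasis
  set b' := hsymm.eigenvectorBasis hdim
  set μ := hsymm.eigenvalues hdim
  have hBb : ∀ i η, B (b' i) η = μ i * inner ℝ (b' i) η := fun i η => by
    rw [← inner_bilinEnd, hsymm.apply_eigenvectorBasis, inner_smul_left]
    simp [μ, b']
  have hdiag : ∀ i j, B (b' i) (b' j) = if i = j then μ i else 0 := fun i j => by
    rw [hBb, b'.inner_eq_ite]; simp
  have hμ : ∀ i, 0 < μ i := fun i => by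
    have := hpos (b' i) (b'.orthonormal.ne_zero i)
    rwa [hdiag, if_pos rfl] at this
  have : Nonempty (Fin (Fintype.card ι)) := ⟨⟨0, by omega⟩⟩
  obtain ⟨o, ho⟩ := Finite.exists_max μ
  have hquad : ∀ ξ, B ξ ξ = ∑ i, μ i * inner ℝ (b' i) ξ ^ 2 := fun ξ => by
    conv_lhs => rw [← b'.sum_repr' ξ]
    simp only [map_sum, map_smul, _root_.sum_apply, _root_.smul_apply, hdiag]
    simp [sq, mul_comm, mul_left_comm]
  have hmax : B ξ₀ ξ₀ ≤ μ o := by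
    rw [hquad]
    calc _ ≤ ∑ i, μ o * inner ℝ (b' i) ξ₀ ^ 2 :=
          Finset.sum_le_sum fun i _ => mul_le_mul_of_nonneg_right (ho i) (sq_nonneg _)
      _ = μ o := by rw [← Finset.mul_sum, b'.sum_sq_inner_right, hξ₀]; simp
  have hW0 := hW.self_of_nhds (b' o) 0
  rw [← e20, ← e10, ← e0] at hW0
  simp only [hdiag, if_true, map_zero, sub_zero, zero_smul, add_zero, b'.norm_eq_one] at hW0
  have hcard' : Fintype.card (Fin (Fintype.card ι)) = Fintype.card ι := Fintype.card_fin _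
  obtain ⟨h1, h2⟩ := umbilic_of_support_function b' (by rwa [hcard']) hg4 (β := β) (c := c) (W := W)
    hβ (by rwa [hcard']) (by rwa [hcard']) hμ hdiag ho hv0 (by
      filter_upwards [hpde, hgv, e2] with z z1 z2 z3
      rw [z3, hcard', det_bilin_orthonormalBasis, ← det_bilin_orthonormalBasis _ b, z1, z2]) (by
      filter_upwards [hW, hgv, e1, e2] with z z1 z2 z3 z4 ξ t
      rw [z2, z3, z4, sum_sq_apply_orthonormalBasis _ b' b]
      -- Equality for the given `ξ₀` must be moved to the top eigenvector `b' o`: the inequality at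
      -- `z = 0` bounds `v 0 * μ o` above, and `B ξ₀ ξ₀ ≤ μ o` bounds it below.
      exact z1 ξ t) (by
      refine le_antisymm ?_ ?_
      · rw [sum_sq_apply_orthonormalBasis _ b' b]
        linarith
      · rw [sum_sq_apply_orthonormalBasis _ b' b, ← heq]
        exact mul_le_mul_of_nonneg_left hmax hv0.le)
  refine ⟨⟨μ o, fun ξ η => ?_⟩, ?_⟩
  · conv_lhs => rw [← b'.sum_repr' ξ]
    simp only [map_sum, map_smul, _root_.sum_apply, _root_.smul_apply, hBb, h1, smul_eq_mul]
    rw [← b'.sum_inner_mul_inner ξ η, Finset.mul_sum]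
    refine Finset.sum_congr rfl fun i _ => ?_
    rw [real_inner_comm]
    ring
  · ext ξ
    rw [← b'.sum_repr' ξ]
    simp [h2]

end LocalSupport

/-! ### The least principal curvature as a minimal Rayleigh quotient. -/

section RayleighQuotient

variable {ι : Type*} [Fintype ι] [DecidableEq ι]

/-- The least generalized eigenvalue of a pair of positive definite matrices. -/
theorem exists_isLeast_eigenvalue [Nonempty ι] {g h : Matrix ι ι ℝ} (hg : g.PosDef)
    (hh : h.PosDef) : ∃ m : ℝ, 0 < m ∧
      IsLeast {c | Module.End.HasEigenvalue (Matrix.toLin' (g⁻¹ * h)) c} m ∧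
      (∀ u, m * (u ⬝ᵥ g *ᵥ u) ≤ u ⬝ᵥ h *ᵥ u) ∧ ∃ u, u ≠ 0 ∧ h *ᵥ u = m • g *ᵥ u := by
  have hgpos : ∀ u : ι → ℝ, u ≠ 0 → 0 < u ⬝ᵥ g *ᵥ u := fun u hu => by
    simpa using hg.dotProduct_mulVec_pos hu
  have hhpos : ∀ u : ι → ℝ, u ≠ 0 → 0 < u ⬝ᵥ h *ᵥ u := fun u hu => by
    simpa using hh.dotProduct_mulVec_pos hu
  have hcont : ∀ A : Matrix ι ι ℝ, Continuous fun u : ι → ℝ => u ⬝ᵥ A *ᵥ u := fun A =>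
    continuous_id.dotProduct (continuous_const.matrix_mulVec continuous_id)
  have hsph : ∀ u ∈ Metric.sphere (0 : ι → ℝ) 1, u ≠ 0 := fun u hu h0 => by
    simp [h0] at hu
  -- The sphere is that of the sup norm; any norm serves, since the quotient is homogeneous of
  -- degree zero.
  obtain ⟨u₀, hu₀, hmin⟩ := (isCompact_sphere (0 : ι → ℝ) 1).exists_isMinOn
    (NormedSpace.sphere_nonempty.2 zero_le_one)
    (f := fun u => (u ⬝ᵥ h *ᵥ u) / (u ⬝ᵥ g *ᵥ u))
    ((hcont h).continuousOn.div (hcont g).continuousOn fun u hu => (hgpos u (hsph u hu)).ne')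
  have hu₀0 := hsph u₀ hu₀
  set m := (u₀ ⬝ᵥ h *ᵥ u₀) / (u₀ ⬝ᵥ g *ᵥ u₀) with hm
  have hm0 : 0 < m := div_pos (hhpos _ hu₀0) (hgpos _ hu₀0)
  have hle : ∀ u, m * (u ⬝ᵥ g *ᵥ u) ≤ u ⬝ᵥ h *ᵥ u := by
    intro u
    by_cases hu : u = 0
    · simp [hu]
    · have hn : 0 < ‖u‖ := norm_pos_iff.2 hu
      have h1 := hmin (show ‖u‖⁻¹ • u ∈ Metric.sphere (0 : ι → ℝ) 1 by
        simp [norm_smul, hn.ne'])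
      simp only [Set.mem_ofPred_eq, mulVec_smul, dotProduct_smul, smul_dotProduct,
        smul_eq_mul] at h1
      rw [mul_div_mul_left _ _ (inv_pos.2 hn).ne', mul_div_mul_left _ _ (inv_pos.2 hn).ne',
        le_div_iff₀ (hgpos u hu)] at h1
      exact h1
  have hpsd : (h - m • g).PosSemidef := by
    refine PosSemidef.of_dotProduct_mulVec_nonneg ?_ fun u => ?_
    · exact hh.isHermitian.sub (by
        rw [IsHermitian, conjTranspose_smul, hg.isHermitian.eq, star_trivial])
    · simp only [star_trivial, sub_mulVec, smul_mulVec, dotProduct_sub, dotProduct_smul,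
        smul_eq_mul, sub_nonneg]
      exact hle u
  -- A vector on which the positive semidefinite form `h - m g` vanishes lies in its kernel.
  have hker : h *ᵥ u₀ = m • g *ᵥ u₀ := by
    have h1 := (hpsd.dotProduct_mulVec_zero_iff u₀).1 (by
      simp only [star_trivial, sub_mulVec, smul_mulVec, dotProduct_sub, dotProduct_smul,
        smul_eq_mul]
      rw [hm, div_mul_cancel₀ _ (hgpos _ hu₀0).ne', sub_self])
    rwa [sub_mulVec, smul_mulVec, sub_eq_zero] at h1
  have hunit : IsUnit g.det := isUnit_iff_ne_zero.2 hg.det_pos.ne'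
  refine ⟨m, hm0, ⟨?_, ?_⟩, hle, u₀, hu₀0, hker⟩
  · refine Module.End.hasEigenvalue_of_hasEigenvector (x := u₀)
      ⟨Module.End.mem_eigenspace_iff.2 ?_, hu₀0⟩
    rw [toLin'_apply, ← mulVec_mulVec, hker, mulVec_smul, mulVec_mulVec, nonsing_inv_mul _ hunit,
      one_mulVec]
  · intro c hc
    obtain ⟨x, hx⟩ := Module.End.HasEigenvalue.exists_hasEigenvector hc
    have h1 := hx.apply_eq_smul
    rw [toLin'_apply, ← mulVec_mulVec] at h1
    have h2 : h *ᵥ x = c • g *ᵥ x := by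
      have := congrArg (g *ᵥ ·) h1
      simpa [mulVec_mulVec, mul_nonsing_inv _ hunit, mulVec_smul,
        mul_nonsing_inv_cancel_left _ _ hunit] using this
    have h3 := hle x
    rw [h2, dotProduct_smul, smul_eq_mul] at h3
    exact le_of_mul_le_mul_right h3 (hgpos x hx.2)

end RayleighQuotient

/-! ### An orthonormal frame adapted to the normal at the base point. -/

section Frame

variable {n : ℕ} (w : OrthonormalBasis (Fin (n + 1)) ℝ (EuclideanSpace ℝ (Fin (n + 1))))

/-- The isometric embedding of `ℝⁿ` onto the orthogonal complement of the first frame vector. -/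
noncomputable def tangentEmbedding :
    EuclideanSpace ℝ (Fin n) →L[ℝ] EuclideanSpace ℝ (Fin (n + 1)) :=
  ∑ k : Fin n, (EuclideanSpace.proj k).smulRight (w k.succ)

theorem tangentEmbedding_apply (z : EuclideanSpace ℝ (Fin n)) :
    tangentEmbedding w z = ∑ k, z k • w k.succ := by
  simp [tangentEmbedding, _root_.sum_apply]

theorem tangentEmbedding_single (k : Fin n) :
    tangentEmbedding w (EuclideanSpace.single k 1) = w k.succ := by
  simp [tangentEmbedding_apply]

theorem inner_tangentEmbedding (y : EuclideanSpace ℝ (Fin (n + 1)))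
    (z : EuclideanSpace ℝ (Fin n)) :
    inner ℝ y (tangentEmbedding w z) = ∑ k, z k * inner ℝ y (w k.succ) := by
  simp [tangentEmbedding_apply, inner_sum, inner_smul_right]

theorem inner_tangentEmbedding_zero (z : EuclideanSpace ℝ (Fin n)) :
    inner ℝ (tangentEmbedding w z) (w 0) = 0 := by
  rw [real_inner_comm, inner_tangentEmbedding]
  refine Finset.sum_eq_zero fun k _ => ?_
  rw [w.inner_eq_zero (Fin.succ_ne_zero k).symm, mul_zero]

theorem inner_tangentEmbedding_succ (z : EuclideanSpace ℝ (Fin n)) (k : Fin n) :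
    inner ℝ (tangentEmbedding w z) (w k.succ) = z k := by
  rw [real_inner_comm, inner_tangentEmbedding]
  simp [w.inner_eq_ite]

theorem inner_eq_frame (x y : EuclideanSpace ℝ (Fin (n + 1))) :
    inner ℝ x y = inner ℝ x (w 0) * inner ℝ y (w 0)
      + ∑ k : Fin n, inner ℝ x (w k.succ) * inner ℝ y (w k.succ) := by
  rw [← w.sum_inner_mul_inner x y, Fin.sum_univ_succ, real_inner_comm y]
  congr 1
  exact Finset.sum_congr rfl fun k _ => by rw [real_inner_comm y]

theorem inner_tangentEmbedding_tangentEmbedding (z z' : EuclideanSpace ℝ (Fin n)) :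
    inner ℝ (tangentEmbedding w z) (tangentEmbedding w z') = inner ℝ z z' := by
  rw [inner_eq_frame w, inner_tangentEmbedding_zero, zero_mul, zero_add, PiLp.inner_apply]
  simp only [inner_tangentEmbedding_succ]
  exact Finset.sum_congr rfl fun k _ => mul_comm _ _

theorem norm_sq_add_tangentEmbedding (t : ℝ) (z : EuclideanSpace ℝ (Fin n)) :
    ‖t • w 0 + tangentEmbedding w z‖ ^ 2 = t ^ 2 + ‖z‖ ^ 2 := by
  rw [norm_add_sq_real, inner_smul_left, real_inner_comm, inner_tangentEmbedding_zero,
    norm_smul, w.norm_eq_one, ← real_inner_self_eq_norm_sq (tangentEmbedding w z),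
    inner_tangentEmbedding_tangentEmbedding, real_inner_self_eq_norm_sq]
  simp

end Frame

/-! ### Curvature in terms of the Hessian of the support function. -/

section Pointwise

variable {n : ℕ} {w : OrthonormalBasis (Fin (n + 1)) ℝ (EuclideanSpace ℝ (Fin (n + 1)))}
  {D : EuclideanSpace ℝ (Fin n) →L[ℝ] EuclideanSpace ℝ (Fin (n + 1))}
  {H : EuclideanSpace ℝ (Fin n) →L[ℝ] EuclideanSpace ℝ (Fin n) →L[ℝ]
    EuclideanSpace ℝ (Fin (n + 1))}
  {ν : EuclideanSpace ℝ (Fin (n + 1))}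
  {R : EuclideanSpace ℝ (Fin n) →ₗ[ℝ] EuclideanSpace ℝ (Fin n)}
  {z : EuclideanSpace ℝ (Fin n)} {ρ : ℝ}
  {b : EuclideanSpace ℝ (Fin n) →L[ℝ] EuclideanSpace ℝ (Fin n) →L[ℝ] ℝ}

/-- The Gram matrix of a linear map. -/
noncomputable def gramMatrix
    (D : EuclideanSpace ℝ (Fin n) →L[ℝ] EuclideanSpace ℝ (Fin (n + 1))) :
    Matrix (Fin n) (Fin n) ℝ :=
  of fun i j => inner ℝ (D (EuclideanSpace.single i 1)) (D (EuclideanSpace.single j 1))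

/-- The matrix of the `ν`-component of a vector valued bilinear form. -/
noncomputable def normalMatrix (H : EuclideanSpace ℝ (Fin n) →L[ℝ] EuclideanSpace ℝ (Fin n) →L[ℝ]
    EuclideanSpace ℝ (Fin (n + 1))) (ν : EuclideanSpace ℝ (Fin (n + 1))) :
    Matrix (Fin n) (Fin n) ℝ :=
  of fun i j => inner ℝ (H (EuclideanSpace.single i 1) (EuclideanSpace.single j 1)) ν

theorem dotProduct_bilin_mulVec (β : LinearMap.BilinForm ℝ (EuclideanSpace ℝ (Fin n)))
    (u u' : Fin n → ℝ) :
    u ⬝ᵥ (of fun i j => β (EuclideanSpace.single i 1) (EuclideanSpace.single j 1)) *ᵥ u'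
      = β (WithLp.toLp 2 u) (WithLp.toLp 2 u') := by
  have h := LinearMap.BilinForm.dotProduct_toMatrix_mulVec
    (EuclideanSpace.basisFun (Fin n) ℝ).toBasis β u u'
  have h1 : LinearMap.BilinForm.toMatrix (EuclideanSpace.basisFun (Fin n) ℝ).toBasis β
      = of fun i j => β (EuclideanSpace.single i 1) (EuclideanSpace.single j 1) := by
    ext i j; simp
  rw [h1] at h
  rw [h]
  rfl

theorem det_bilin_comp (β : LinearMap.BilinForm ℝ (EuclideanSpace ℝ (Fin n)))
    (R : EuclideanSpace ℝ (Fin n) →ₗ[ℝ] EuclideanSpace ℝ (Fin n)) :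
    (of fun i j => β (R (EuclideanSpace.single i 1)) (R (EuclideanSpace.single j 1))).det
      = LinearMap.det R ^ 2 *
        (of fun i j => β (EuclideanSpace.single i 1) (EuclideanSpace.single j 1)).det := by
  have h := LinearMap.BilinForm.toMatrix_comp (EuclideanSpace.basisFun (Fin n) ℝ).toBasis
    (EuclideanSpace.basisFun (Fin n) ℝ).toBasis β R R
  have h1 : ∀ γ : LinearMap.BilinForm ℝ (EuclideanSpace ℝ (Fin n)),
      LinearMap.BilinForm.toMatrix (EuclideanSpace.basisFun (Fin n) ℝ).toBasis γ
      = of fun i j => γ (EuclideanSpace.single i 1) (EuclideanSpace.single j 1) := by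
    intro γ; ext i j; simp
  rw [h1, h1] at h
  have h2 := congrArg Matrix.det h
  rw [det_mul, det_mul, det_transpose, LinearMap.det_toMatrix] at h2
  simp only [LinearMap.BilinForm.comp_apply] at h2
  rw [h2]
  ring

/-- The first fundamental form as a bilinear form. -/
noncomputable def gramForm (D : EuclideanSpace ℝ (Fin n) →L[ℝ] EuclideanSpace ℝ (Fin (n + 1))) :
    LinearMap.BilinForm ℝ (EuclideanSpace ℝ (Fin n)) :=
  LinearMap.mk₂ ℝ (fun x y => inner ℝ (D x) (D y))
    (by simp [inner_add_left]) (by simp [inner_smul_left]) (by simp [inner_add_right])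
    (by simp [inner_smul_right])

/-- The `ν`-component of a vector valued bilinear form. -/
noncomputable def normalForm (H : EuclideanSpace ℝ (Fin n) →L[ℝ] EuclideanSpace ℝ (Fin n) →L[ℝ]
    EuclideanSpace ℝ (Fin (n + 1))) (ν : EuclideanSpace ℝ (Fin (n + 1))) :
    LinearMap.BilinForm ℝ (EuclideanSpace ℝ (Fin n)) :=
  LinearMap.mk₂ ℝ (fun x y => inner ℝ (H x y) ν)
    (by simp [inner_add_left]) (by simp [inner_smul_left]) (by simp [inner_add_left])
    (by simp [inner_smul_left])

theorem dotProduct_gramMatrix_mulVec (u u' : Fin n → ℝ) : u ⬝ᵥ gramMatrix D *ᵥ u'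
    = inner ℝ (D (WithLp.toLp 2 u)) (D (WithLp.toLp 2 u')) :=
  dotProduct_bilin_mulVec (gramForm D) u u'

theorem dotProduct_normalMatrix_mulVec (u u' : Fin n → ℝ) : u ⬝ᵥ normalMatrix H ν *ᵥ u'
    = inner ℝ (H (WithLp.toLp 2 u) (WithLp.toLp 2 u')) ν :=
  dotProduct_bilin_mulVec (normalForm H ν) u u'

theorem posDef_gramMatrix (hD : Function.Injective D) : (gramMatrix D).PosDef := by
  refine PosDef.of_dotProduct_mulVec_pos ?_ fun u hu => ?_
  · ext i j
    simp [gramMatrix, real_inner_comm]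
  · rw [star_trivial, dotProduct_gramMatrix_mulVec, real_inner_self_eq_norm_sq]
    have : D (WithLp.toLp 2 u) ≠ 0 := fun h => hu (by
      have := hD (h.trans (map_zero D).symm)
      simpa using this)
    positivity

theorem inner_bilin_symm_of_posDef (h : (normalMatrix H ν).PosDef) (x y : EuclideanSpace ℝ (Fin n)) :
    inner ℝ (H x y) ν = inner ℝ (H y x) ν := by
  have h1 := dotProduct_normalMatrix_mulVec (H := H) (ν := ν) x.ofLp y.ofLp
  have h2 := dotProduct_normalMatrix_mulVec (H := H) (ν := ν) y.ofLp x.ofLp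
  have h3 : (normalMatrix H ν)ᵀ = normalMatrix H ν := by
    rw [← conjTranspose_eq_transpose_of_trivial]; exact h.isHermitian
  rw [dotProduct_mulVec, ← mulVec_transpose, h3, dotProduct_comm] at h1
  exact h1.symm.trans h2

theorem inner_bilin_pos_of_posDef (h : (normalMatrix H ν).PosDef) (x : EuclideanSpace ℝ (Fin n)) (hx : x ≠ 0) :
    0 < inner ℝ (H x x) ν := by
  have := h.dotProduct_mulVec_pos (x := x.ofLp) (by simpa using hx)
  rwa [star_trivial, dotProduct_normalMatrix_mulVec] at this

/-- The relations between the differential `D`, the second fundamental form and the support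
function at a point whose normal direction is `w 0 + z`: here `b` is the Hessian of the support
function and `R` the derivative of the inverse Gauss map. -/
structure IsGaussParametrized
    (w : OrthonormalBasis (Fin (n + 1)) ℝ (EuclideanSpace ℝ (Fin (n + 1))))
    (D : EuclideanSpace ℝ (Fin n) →L[ℝ] EuclideanSpace ℝ (Fin (n + 1)))
    (H : EuclideanSpace ℝ (Fin n) →L[ℝ] EuclideanSpace ℝ (Fin n) →L[ℝ]
      EuclideanSpace ℝ (Fin (n + 1)))
    (ν : EuclideanSpace ℝ (Fin (n + 1)))
    (R : EuclideanSpace ℝ (Fin n) →ₗ[ℝ] EuclideanSpace ℝ (Fin n))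
    (z : EuclideanSpace ℝ (Fin n)) (ρ : ℝ)
    (b : EuclideanSpace ℝ (Fin n) →L[ℝ] EuclideanSpace ℝ (Fin n) →L[ℝ] ℝ) : Prop where
  injective : Function.Injective D
  bijective : Function.Bijective R
  posDef : (normalMatrix H ν).PosDef
  pos : 0 < ρ
  sq_eq : ρ ^ 2 = 1 + ‖z‖ ^ 2
  normal : ∀ η, inner ℝ (D (R η)) (w 0 + tangentEmbedding w z) = 0
  hess_eq_inner : ∀ η η', b η η' = inner ℝ (D (R η)) (tangentEmbedding w η')
  hess_eq_second : ∀ η η', b η η' = ρ * inner ℝ (H (R η) (R η')) ν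

namespace IsGaussParametrized

variable (h : IsGaussParametrized w D H ν R z ρ b)
include h

theorem inner_zero (η : EuclideanSpace ℝ (Fin n)) : inner ℝ (D (R η)) (w 0) = -b η z := by
  have := h.normal η
  rw [inner_add_right, ← h.hess_eq_inner] at this
  linarith

theorem inner_succ (η : EuclideanSpace ℝ (Fin n)) (k : Fin n) :
    inner ℝ (D (R η)) (w k.succ) = b η (EuclideanSpace.single k 1) := by
  rw [h.hess_eq_inner, tangentEmbedding_single]

theorem gram (η η' : EuclideanSpace ℝ (Fin n)) : inner ℝ (D (R η)) (D (R η')) =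
    b η z * b η' z + ∑ k, b η (EuclideanSpace.single k 1) * b η' (EuclideanSpace.single k 1) := by
  rw [inner_eq_frame w]
  simp only [h.inner_zero, h.inner_succ]
  ring

theorem symm (η η' : EuclideanSpace ℝ (Fin n)) : b η η' = b η' η := by
  rw [h.hess_eq_second, h.hess_eq_second, inner_bilin_symm_of_posDef h.posDef]

theorem hess_pos (η : EuclideanSpace ℝ (Fin n)) (hη : η ≠ 0) : 0 < b η η := by
  rw [h.hess_eq_second]
  exact mul_pos h.pos (inner_bilin_pos_of_posDef h.posDef _ fun h0 => hη (h.bijective.1 (h0.trans (map_zero R).symm)))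

theorem det_hess_pos :
    0 < (of fun i j => b (EuclideanSpace.single i 1) (EuclideanSpace.single j 1)).det := by
  refine PosDef.det_pos (PosDef.of_dotProduct_mulVec_pos ?_ fun u hu => ?_)
  · ext i j
    simp [h.symm (EuclideanSpace.single i 1)]
  · let β : LinearMap.BilinForm ℝ (EuclideanSpace ℝ (Fin n)) :=
      LinearMap.mk₂ ℝ (fun x y => b x y) (by simp) (by simp) (by simp) (by simp)
    have := dotProduct_bilin_mulVec β u u
    rw [star_trivial]
    exact (h.hess_pos (WithLp.toLp 2 u) (by simpa using hu)).trans_eq this.symm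

/-- Pulling back by `R` gives `B = ρ Rᵀ h R` and `Rᵀ g R = B (1 + z zᵀ) Bᵀ`, where `det (1 + z zᵀ) =
ρ²`. Comparing determinants eliminates `det R`. -/
theorem det_weingarten : ((gramMatrix D)⁻¹ * normalMatrix H ν).det =
    ((of fun i j => b (EuclideanSpace.single i 1) (EuclideanSpace.single j 1)).det
      * ρ ^ (n + 2))⁻¹ := by
  set B := of fun i j => b (EuclideanSpace.single i 1) (EuclideanSpace.single j 1) with hB
  have hBpos : 0 < B.det := h.det_hess_pos
  have hR : LinearMap.det R ≠ 0 := by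
    have := (LinearEquiv.ofBijective R h.bijective).isUnit_det'
    exact this.ne_zero
  have h1 : (of fun i j => b (EuclideanSpace.single i 1) (EuclideanSpace.single j 1)).det
      = ρ ^ n * (LinearMap.det R ^ 2 * (normalMatrix H ν).det) := by
    have e1 := det_bilin_comp (normalForm H ν) R
    have e2 : (of fun i j => b (EuclideanSpace.single i 1) (EuclideanSpace.single j 1))
        = ρ • of fun i j => normalForm H ν (R (EuclideanSpace.single i 1))
            (R (EuclideanSpace.single j 1)) := by
      ext i j
      exact h.hess_eq_second _ _
    rw [e2, det_smul, Fintype.card_fin, e1]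
    rfl
  have h2 : LinearMap.det R ^ 2 * (gramMatrix D).det = B.det ^ 2 * ρ ^ 2 := by
    have e1 := det_bilin_comp (gramForm D) R
    have hbz : ∀ i, b (EuclideanSpace.single i 1) z = (B *ᵥ z.ofLp) i := by
      intro i
      conv_lhs => rw [← (EuclideanSpace.basisFun (Fin n) ℝ).sum_repr z]
      simp [B, mulVec, dotProduct, mul_comm]
    have e2 : (of fun i j => gramForm D (R (EuclideanSpace.single i 1))
        (R (EuclideanSpace.single j 1)))
        = B * (1 + replicateCol Unit z.ofLp * replicateRow Unit z.ofLp) * Bᵀ := by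
      ext i j
      have := h.gram (EuclideanSpace.single i 1) (EuclideanSpace.single j 1)
      refine this.trans ?_
      rw [hbz, hbz, mul_add, mul_one, add_mul, Matrix.add_apply, add_comm]
      congr 1
      have : B * (replicateCol Unit z.ofLp * replicateRow Unit z.ofLp) * Bᵀ
          = replicateCol Unit (B *ᵥ z.ofLp) * replicateRow Unit (B *ᵥ z.ofLp) := by
        rw [← Matrix.mul_assoc, replicateCol_mulVec, Matrix.mul_assoc]
        congr 1
        rw [← vecMul_transpose, replicateRow_vecMul]
      rw [this]
      simp [Matrix.mul_apply]
    rw [show (gramMatrix D).det = (of fun i j => gramForm D (EuclideanSpace.single i 1)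
      (EuclideanSpace.single j 1)).det from rfl, ← e1, e2, det_mul, det_mul, det_transpose,
      det_one_add_replicateCol_mul_replicateRow, h.sq_eq]
    have : z.ofLp ⬝ᵥ z.ofLp = ‖z‖ ^ 2 := by
      rw [EuclideanSpace.real_norm_sq_eq]
      simp [dotProduct, sq]
    rw [this]
    ring
  have hρ := h.pos
  rw [← hB] at h1
  have hg : (gramMatrix D).det ≠ 0 := (posDef_gramMatrix h.injective).det_pos.ne'
  rw [det_mul, det_nonsing_inv, Ring.inverse_eq_inv']
  field_simp
  have h3 : LinearMap.det R ^ 2 * ((normalMatrix H ν).det * B.det * ρ ^ (n + 2))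
      = LinearMap.det R ^ 2 * (gramMatrix D).det := by
    rw [h2, pow_add]
    linear_combination (-(B.det * ρ ^ 2)) * h1
  have h4 := mul_left_cancel₀ (pow_ne_zero 2 hR) h3
  linarith

/-- This is the smooth substitute for `λ_min⁻¹`. Adding a multiple of the normal does not change the
pairing with a tangent vector, so `b ξ ξ` pairs `D (R ξ)` with every `t w₀ + ξ + t z`.
Cauchy-Schwarz and the bound `m g ≤ h` then give the inequality. -/
theorem exists_least_curvature (hn : 0 < n) : ∃ m : ℝ, 0 < m ∧
    sInf {c | Module.End.HasEigenvalue
      (Matrix.toLin' ((gramMatrix D)⁻¹ * normalMatrix H ν)) c} = m ∧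
    (∀ (ξ : EuclideanSpace ℝ (Fin n)) (t : ℝ), b ξ ξ * (ρ * m) ≤ ‖ξ + t • z‖ ^ 2 + t ^ 2) ∧
    (z = 0 → ∃ ξ : EuclideanSpace ℝ (Fin n), ‖ξ‖ = 1 ∧ b ξ ξ * (ρ * m) = 1) := by
  have : Nonempty (Fin n) := ⟨⟨0, hn⟩⟩
  obtain ⟨m, hm, hleast, hle, u, hu0, hu⟩ :=
    exists_isLeast_eigenvalue (posDef_gramMatrix h.injective) h.posDef
  refine ⟨m, hm, hleast.csInf_eq, fun ξ t => ?_, fun hz => ?_⟩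
  · by_cases hξ : ξ = 0
    · simp [hξ]; positivity
    have hb := h.hess_pos ξ hξ
    have h1 := hle (R ξ).ofLp
    rw [dotProduct_gramMatrix_mulVec, dotProduct_normalMatrix_mulVec] at h1
    change m * inner ℝ (D (R ξ)) (D (R ξ)) ≤ inner ℝ (H (R ξ) (R ξ)) ν at h1
    have h2 : ρ * m * inner ℝ (D (R ξ)) (D (R ξ)) ≤ b ξ ξ := by
      rw [h.hess_eq_second, mul_assoc]
      exact mul_le_mul_of_nonneg_left h1 h.pos.le
    have h3 : b ξ ξ = inner ℝ (D (R ξ)) (t • w 0 + tangentEmbedding w (ξ + t • z)) := by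
      have := h.normal ξ
      rw [inner_add_right] at this
      rw [map_add, map_smul, inner_add_right, inner_add_right, inner_smul_right, inner_smul_right,
        h.hess_eq_inner]
      linear_combination (-t) * this
    have h4 := real_inner_mul_inner_self_le (D (R ξ)) (t • w 0 + tangentEmbedding w (ξ + t • z))
    rw [← h3, real_inner_self_eq_norm_sq (t • w 0 + tangentEmbedding w (ξ + t • z)),
      norm_sq_add_tangentEmbedding] at h4
    have hρm : 0 < ρ * m := mul_pos h.pos hm
    have h5 : b ξ ξ * (b ξ ξ * (ρ * m)) ≤ b ξ ξ * (‖ξ + t • z‖ ^ 2 + t ^ 2) := by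
      calc b ξ ξ * (b ξ ξ * (ρ * m)) = (b ξ ξ * b ξ ξ) * (ρ * m) := by ring
        _ ≤ (inner ℝ (D (R ξ)) (D (R ξ)) * (t ^ 2 + ‖ξ + t • z‖ ^ 2)) * (ρ * m) :=
          mul_le_mul_of_nonneg_right h4 hρm.le
        _ = (ρ * m * inner ℝ (D (R ξ)) (D (R ξ))) * (‖ξ + t • z‖ ^ 2 + t ^ 2) := by ring
        _ ≤ _ := mul_le_mul_of_nonneg_right h2 (by positivity)
    exact le_of_mul_le_mul_left h5 hb
  · subst hz
    obtain ⟨η, hη⟩ := h.bijective.2 (WithLp.toLp 2 u)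
    have hη0 : η ≠ 0 := by
      rintro rfl
      rw [map_zero] at hη
      exact hu0 (by simpa using hη.symm)
    have h1 : ∀ η', b η η' = ρ * m * inner ℝ (D (R η)) (D (R η')) := by
      intro η'
      have e := congrArg ((R η').ofLp ⬝ᵥ ·) hu
      simp only [dotProduct_smul, dotProduct_gramMatrix_mulVec, dotProduct_normalMatrix_mulVec,
        smul_eq_mul] at e
      rw [← hη] at e
      change inner ℝ (H (R η') (R η)) ν = m * inner ℝ (D (R η')) (D (R η)) at e
      rw [h.symm, h.hess_eq_second, e, real_inner_comm]
      ring
    -- At `z = 0` this `ξ` represents the tangent vector `D (R η)` of least curvature in the frame,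
    -- which is the equality case of both estimates.
    set ξ : EuclideanSpace ℝ (Fin n) :=
      ∑ k, b η (EuclideanSpace.single k 1) • EuclideanSpace.single k (1 : ℝ) with hξ
    have hbξ : ∀ η', b η' ξ = inner ℝ (D (R η)) (D (R η')) := by
      intro η'
      rw [h.gram, hξ]
      simp
    have hξη : ∀ η', inner ℝ ξ η' = b η η' := by
      intro η'
      conv_rhs => rw [← (EuclideanSpace.basisFun (Fin n) ℝ).sum_repr η']
      rw [hξ, sum_inner]
      simp [inner_smul_left, mul_comm, EuclideanSpace.inner_single_left]
    have hkey : b ξ ξ * (ρ * m) = ‖ξ‖ ^ 2 := by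
      rw [← real_inner_self_eq_norm_sq, hξη, h1 ξ, hbξ ξ]
      ring
    have hξ0 : ξ ≠ 0 := by
      intro h0
      have := hξη η
      rw [h0, inner_zero_left] at this
      exact (h.hess_pos η hη0).ne this
    have hnξ : 0 < ‖ξ‖ := norm_pos_iff.2 hξ0
    refine ⟨‖ξ‖⁻¹ • ξ, by simp [norm_smul, hnξ.ne'], ?_⟩
    simp only [map_smul, _root_.smul_apply, smul_eq_mul]
    have : ‖ξ‖⁻¹ * (‖ξ‖⁻¹ * b ξ ξ) * (ρ * m) = ‖ξ‖⁻¹ * (‖ξ‖⁻¹ * (b ξ ξ * (ρ * m))) := by ring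
    rw [this, hkey]
    field_simp

theorem umbilic_of_hess_eq (hn : 0 < n) {m : ℝ} (hz : z = 0)
    (hb : ∀ ξ η, b ξ η = m * inner ℝ ξ η) :
    ∃ c : ℝ, normalMatrix H ν = c • gramMatrix D := by
  subst hz
  have hρ : ρ = 1 := by
    have := h.sq_eq
    simp only [norm_zero, ne_eq, OfNat.ofNat_ne_zero, not_false_eq_true, zero_pow, add_zero] at this
    nlinarith [h.pos]
  have hm : m ≠ 0 := by
    rintro rfl
    have h0 : (EuclideanSpace.single (⟨0, hn⟩ : Fin n) (1 : ℝ)) ≠ 0 := by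
      intro h0
      have := congrArg norm h0
      simp at this
    exact (h.hess_pos _ h0).ne' (by simp [hb])
  refine ⟨m⁻¹, ?_⟩
  ext i j
  obtain ⟨η, hη⟩ := h.bijective.2 (EuclideanSpace.single i 1)
  obtain ⟨η', hη'⟩ := h.bijective.2 (EuclideanSpace.single j 1)
  have h1 := h.hess_eq_second η η'
  have h2 := h.gram η η'
  rw [hη, hη', hρ, one_mul, hb] at h1
  rw [hη, hη'] at h2
  simp only [hb] at h2
  have h3 : inner ℝ η η' = ∑ k, inner ℝ η (EuclideanSpace.single k (1 : ℝ))
      * inner ℝ η' (EuclideanSpace.single k (1 : ℝ)) := by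
    simp [PiLp.inner_apply, mul_comm]
  change inner ℝ (H _ _) ν = m⁻¹ * inner ℝ (D _) (D _)
  rw [← h1, h2, h3, inner_zero_right, mul_zero, zero_mul, zero_add, Finset.mul_sum, Finset.mul_sum]
  refine Finset.sum_congr rfl fun k _ => ?_
  field_simp

end IsGaussParametrized

end Pointwise

/-! ### The inverse Gauss map and derivatives of the support function. -/

section InverseGauss

variable {n : ℕ} (w : OrthonormalBasis (Fin (n + 1)) ℝ (EuclideanSpace ℝ (Fin (n + 1))))
  {f : EuclideanSpace ℝ (Fin n) → EuclideanSpace ℝ (Fin (n + 1))} {x₀ : EuclideanSpace ℝ (Fin n)}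

/-- Near a point where the second fundamental form is definite, a hypersurface can be parametrized
by its normal direction. -/
theorem exists_inverse_gauss_map (hf : ContDiffAt ℝ 5 f x₀)
    (hn : ∀ u, inner ℝ (fderiv ℝ f x₀ u) (w 0) = 0)
    (hneg : ∀ u, u ≠ 0 → inner ℝ (fderiv ℝ (fderiv ℝ f) x₀ u u) (w 0) < 0) :
    ∃ σ : EuclideanSpace ℝ (Fin n) → EuclideanSpace ℝ (Fin n), ContDiffAt ℝ 4 σ 0 ∧ σ 0 = x₀ ∧
      ∀ᶠ z in 𝓝 0, ∀ u, inner ℝ (fderiv ℝ f (σ z) u) (w 0 + tangentEmbedding w z) = 0 := by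
  let G : EuclideanSpace ℝ (Fin n) × EuclideanSpace ℝ (Fin n) →
      EuclideanSpace ℝ (Fin n) →L[ℝ] ℝ := fun q =>
    (innerSL ℝ (w 0 + tangentEmbedding w q.1)).comp (fderiv ℝ f q.2)
  have hdf : ContDiffAt ℝ 4 (fderiv ℝ f) x₀ := hf.fderiv_right (by norm_num)
  have hG : ContDiffAt ℝ 4 G (0, x₀) := by
    refine ContDiffAt.clm_comp ?_ (hdf.comp (0, x₀) contDiffAt_snd)
    exact ((innerSL ℝ).contDiff.comp
      (contDiff_const.add ((tangentEmbedding w).contDiff.comp contDiff_fst))).contDiffAt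
  have hG0 : G (0, x₀) = 0 := by
    ext u
    simp only [G, map_zero, add_zero, ContinuousLinearMap.comp_apply, innerSL_apply_apply,
      _root_.zero_apply]
    rw [real_inner_comm, hn]
  have hder : ∀ u u', (fderiv ℝ G (0, x₀) ∘L .inr ℝ _ _) u u'
      = inner ℝ (fderiv ℝ (fderiv ℝ f) x₀ u u') (w 0) := by
    have h1 : HasFDerivAt (fun x => G (0, x)) (fderiv ℝ G (0, x₀) ∘L .inr ℝ _ _) x₀ :=
      (hG.differentiableAt (by norm_num)).hasFDerivAt.comp x₀ (hasFDerivAt_prodMk_right 0 x₀)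
    have h2 : HasFDerivAt (fun x => G (0, x))
        (((ContinuousLinearMap.compL ℝ _ _ ℝ) (innerSL ℝ (w 0 + tangentEmbedding w 0))).comp
          (fderiv ℝ (fderiv ℝ f) x₀)) x₀ := by
      change HasFDerivAt (fun x => (ContinuousLinearMap.compL ℝ _ _ ℝ)
        (innerSL ℝ (w 0 + tangentEmbedding w 0)) (fderiv ℝ f x)) _ x₀
      exact ContinuousLinearMap.hasFDerivAt _ |>.comp x₀
        (hdf.differentiableAt (by norm_num)).hasFDerivAt
    intro u u'
    rw [h1.unique h2]
    simp [real_inner_comm]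
  -- The partial derivative in the position variable is the second fundamental form along `w 0`;
  -- definiteness makes it injective, hence invertible by dimension, as the implicit function
  -- theorem requires.
  have hinv : (fderiv ℝ G (0, x₀) ∘L .inr ℝ _ _).IsInvertible := by
    set A := fderiv ℝ G (0, x₀) ∘L .inr ℝ _ _
    have hinj : Function.Injective (A : EuclideanSpace ℝ (Fin n) →ₗ[ℝ]
        (EuclideanSpace ℝ (Fin n) →L[ℝ] ℝ)) := by
      rw [← LinearMap.ker_eq_bot, LinearMap.ker_eq_bot']
      intro u hu
      by_contra h0
      have h1 := hder u u
      have h2 : A u = 0 := hu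
      rw [h2] at h1
      exact (hneg u h0).ne h1.symm
    have hrank : Module.finrank ℝ (EuclideanSpace ℝ (Fin n))
        = Module.finrank ℝ (EuclideanSpace ℝ (Fin n) →L[ℝ] ℝ) := by
      rw [← (LinearMap.toContinuousLinearMap (𝕜 := ℝ) (E := EuclideanSpace ℝ (Fin n))
        (F' := ℝ)).finrank_eq, Module.finrank_linearMap_self]
    refine ⟨(LinearEquiv.ofInjectiveOfFinrankEq _ hinj hrank).toContinuousLinearEquiv, ?_⟩
    ext u
    rfl
  refine ⟨hG.implicitFunction (by norm_num) hinv, hG.contDiffAt_implicitFunction _ hinv,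
    hG.implicitFunction_apply_self _ hinv, ?_⟩
  filter_upwards [hG.eventually_apply_implicitFunction (by norm_num) hinv] with z hz u
  rw [hG0] at hz
  have := congrArg (fun L : EuclideanSpace ℝ (Fin n) →L[ℝ] ℝ => L u) hz
  rw [real_inner_comm]
  exact this

/-- First and second derivatives of the support function in terms of the inverse Gauss map. -/
theorem support_function_derivatives (hf : ContDiffAt ℝ 5 f x₀)
    {σ : EuclideanSpace ℝ (Fin n) → EuclideanSpace ℝ (Fin n)} (hσ : ContDiffAt ℝ 4 σ 0)
    (hσ0 : σ 0 = x₀)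
    (hnorm : ∀ᶠ z in 𝓝 0, ∀ u, inner ℝ (fderiv ℝ f (σ z) u) (w 0 + tangentEmbedding w z) = 0)
    {v : EuclideanSpace ℝ (Fin n) → ℝ}
    (hv : v = fun z => inner ℝ (f (σ z)) (w 0 + tangentEmbedding w z)) :
    ContDiffAt ℝ 4 v 0 ∧
    (∀ᶠ z in 𝓝 0, ∀ η, fderiv ℝ v z η = inner ℝ (f (σ z)) (tangentEmbedding w η)) ∧
    (∀ᶠ z in 𝓝 0, ∀ η η', fderiv ℝ (fderiv ℝ v) z η η'
      = inner ℝ (fderiv ℝ f (σ z) (fderiv ℝ σ z η)) (tangentEmbedding w η')) ∧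
    ∀ᶠ z in 𝓝 0, ∀ η u, inner ℝ (fderiv ℝ (fderiv ℝ f) (σ z) (fderiv ℝ σ z η) u)
      (w 0 + tangentEmbedding w z) + inner ℝ (fderiv ℝ f (σ z) u) (tangentEmbedding w η) = 0 := by
  subst hσ0
  have hfσ : ∀ᶠ z in 𝓝 0, ContDiffAt ℝ 5 f (σ z) :=
    hσ.continuousAt.eventually (hf.eventually (by simp))
  have hσe : ∀ᶠ z in 𝓝 0, ContDiffAt ℝ 4 σ z := hσ.eventually (by simp)
  have hN : ∀ z, HasFDerivAt (fun z => w 0 + tangentEmbedding w z) (tangentEmbedding w) z :=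
    fun z => (tangentEmbedding w).hasFDerivAt.const_add _
  have h4 : ContDiffAt ℝ 4 v 0 := by
    rw [hv]
    exact ((hf.of_le (by norm_num)).comp 0 hσ).inner ℝ
      (contDiff_const.add (tangentEmbedding w).contDiff).contDiffAt
  -- The variation of `σ` moves `f` tangentially, so it contributes nothing against the normal, and
  -- `Dv` involves no derivative of `σ`.
  have hd1 : ∀ᶠ z in 𝓝 0, ∀ η, fderiv ℝ v z η = inner ℝ (f (σ z)) (tangentEmbedding w η) := by
    filter_upwards [hfσ, hσe, hnorm] with z z1 z2 z3 η
    have h1 := ((z1.differentiableAt (by norm_num)).hasFDerivAt.comp z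
      (z2.differentiableAt (by norm_num)).hasFDerivAt).inner ℝ (hN z)
    rw [hv]
    have h2 := h1.fderiv
    simp only [Function.comp_apply] at h2
    rw [h2]
    simp [fderivInnerCLM_apply, z3]
  refine ⟨h4, hd1, ?_, ?_⟩
  · filter_upwards [hd1.eventually_nhds, hfσ, hσe] with z z1 z2 z3 η η'
    have e : fderiv ℝ v =ᶠ[𝓝 z] fun y => (innerSL ℝ (f (σ y))).comp (tangentEmbedding w) := by
      filter_upwards [z1] with y hy
      ext η
      simpa using hy η
    have h1 : HasFDerivAt (fun y => ((innerSL ℝ (f (σ y))).comp (tangentEmbedding w)) η') _ z :=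
      ((z2.differentiableAt (by norm_num)).hasFDerivAt.comp z
        (z3.differentiableAt (by norm_num)).hasFDerivAt).inner ℝ
          (hasFDerivAt_const (tangentEmbedding w η') z)
    have h2 : DifferentiableAt ℝ (fderiv ℝ v) z := by
      refine DifferentiableAt.congr_of_eventuallyEq ?_ e
      refine DifferentiableAt.clm_comp ?_ (differentiableAt_const _)
      exact (innerSL ℝ).differentiableAt.comp z
        ((z2.differentiableAt (by norm_num)).comp z (z3.differentiableAt (by norm_num)))
    have h3 : HasFDerivAt (fun y => fderiv ℝ v y η') ((fderiv ℝ (fderiv ℝ v) z).flip η') z := by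
      have := h2.hasFDerivAt.clm_apply (hasFDerivAt_const η' z)
      refine this.congr_fderiv ?_
      ext; simp
    have h5 := h3.unique (h1.congr_of_eventuallyEq (by
      filter_upwards [e] with y hy
      rw [hy]))
    have h6 := congrArg (fun L : EuclideanSpace ℝ (Fin n) →L[ℝ] ℝ => L η) h5
    simpa [fderivInnerCLM_apply] using h6
  · filter_upwards [hnorm.eventually_nhds, hfσ, hσe] with z z1 z2 z3 η u
    have hdf : ContDiffAt ℝ 4 (fderiv ℝ f) (σ z) := z2.fderiv_right (by norm_num)
    have h1 : HasFDerivAt (fun y => fderiv ℝ f (σ y) u)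
        (((fderiv ℝ (fderiv ℝ f) (σ z)).flip u).comp (fderiv ℝ σ z)) z := by
      have := ((hdf.differentiableAt (by norm_num)).hasFDerivAt.comp z
        (z3.differentiableAt (by norm_num)).hasFDerivAt).clm_apply (hasFDerivAt_const u z)
      refine this.congr_fderiv ?_
      ext; simp
    have h2 := h1.inner ℝ (hN z)
    have h3 := h2.unique ((hasFDerivAt_const (0 : ℝ) z).congr_of_eventuallyEq (by
      filter_upwards [z1] with y hy
      exact hy u))
    have h6 := congrArg (fun L : EuclideanSpace ℝ (Fin n) →L[ℝ] ℝ => L η) h3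
    simp [fderivInnerCLM_apply] at h6
    linarith

end InverseGauss

/-! ### Change of chart. -/

section Charts

variable {n : ℕ} {M : Type*} [TopologicalSpace M] [ChartedSpace (EuclideanSpace ℝ (Fin n)) M]
  {F : M → EuclideanSpace ℝ (Fin (n + 1))}

theorem IsSmoothImmersion.injective_fderiv_localRep (hF : IsSmoothImmersion F) (p : M) :
    Function.Injective (fderiv ℝ (localRep F p) (extChartAt (𝓡 n) p p)) := by
  have h := hF.injective_mfderiv p
  have hd : MDifferentiableAt (𝓡 n) 𝓘(ℝ, EuclideanSpace ℝ (Fin (n + 1))) F p :=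
    hF.contMDiff.mdifferentiableAt (by simp)
  rw [hd.mfderiv] at h
  simpa [writtenInExtChartAt, localRep] using! h

variable [IsManifold (𝓡 n) ∞ M]

theorem contDiffAt_localRep
    (hF : ContMDiff (𝓡 n) 𝓘(ℝ, EuclideanSpace ℝ (Fin (n + 1))) ∞ F) (p : M)
    {x : EuclideanSpace ℝ (Fin n)} (hx : x ∈ (extChartAt (𝓡 n) p).target) :
    ContDiffAt ℝ ∞ (localRep F p) x := by
  rw [← contMDiffAt_iff_contDiffAt]
  exact hF.contMDiffAt.comp x ((contMDiffOn_extChartAt_symm p).contMDiffAt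
    ((isOpen_extChartAt_target p).mem_nhds hx))

/-- Transformation of first and second derivatives under a change of chart. -/
theorem exists_chart_change
    (hF : ContMDiff (𝓡 n) 𝓘(ℝ, EuclideanSpace ℝ (Fin (n + 1))) ∞ F) {p₀ p : M}
    (hp : p ∈ (extChartAt (𝓡 n) p₀).source) :
    ∃ (T : EuclideanSpace ℝ (Fin n) →L[ℝ] EuclideanSpace ℝ (Fin n))
      (K : EuclideanSpace ℝ (Fin n) →L[ℝ] EuclideanSpace ℝ (Fin n) →L[ℝ]
        EuclideanSpace ℝ (Fin n)),
      (∀ u, fderiv ℝ (localRep F p) (extChartAt (𝓡 n) p p) u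
        = fderiv ℝ (localRep F p₀) (extChartAt (𝓡 n) p₀ p) (T u)) ∧
      ∀ u u', fderiv ℝ (fderiv ℝ (localRep F p)) (extChartAt (𝓡 n) p p) u u'
        = fderiv ℝ (fderiv ℝ (localRep F p₀)) (extChartAt (𝓡 n) p₀ p) (T u) (T u')
          + fderiv ℝ (localRep F p₀) (extChartAt (𝓡 n) p₀ p) (K u u') := by
  set τ := extChartAt (𝓡 n) p₀ ∘ (extChartAt (𝓡 n) p).symm with hτ
  set y := extChartAt (𝓡 n) p p with hy
  have hyt : y ∈ (extChartAt (𝓡 n) p).target := mem_extChartAt_target p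
  have hsy : (extChartAt (𝓡 n) p).symm y = p := extChartAt_to_inv p
  have hτy : τ y = extChartAt (𝓡 n) p₀ p := congrArg _ hsy
  have hτs : ContDiffAt ℝ ∞ τ y := by
    rw [← contMDiffAt_iff_contDiffAt]
    refine ContMDiffAt.comp y (I' := 𝓡 n) ?_ ((contMDiffOn_extChartAt_symm p).contMDiffAt
      ((isOpen_extChartAt_target p).mem_nhds hyt))
    rw [hsy]
    exact contMDiffAt_extChartAt' (by simpa using hp)
  have hf : ContDiffAt ℝ ∞ (localRep F p₀) (τ y) := by
    rw [hτy]
    exact contDiffAt_localRep hF p₀ ((extChartAt (𝓡 n) p₀).map_source hp)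
  have heq : localRep F p =ᶠ[𝓝 y] localRep F p₀ ∘ τ := by
    have hc : ContinuousAt (extChartAt (𝓡 n) p).symm y := continuousAt_extChartAt_symm p
    have hmem : (extChartAt (𝓡 n) p₀).source ∈ 𝓝 ((extChartAt (𝓡 n) p).symm y) := by
      rw [hsy]
      exact (isOpen_extChartAt_source p₀).mem_nhds hp
    filter_upwards [hc hmem] with x hx
    simp only [localRep, hτ, Function.comp_apply]
    rw [(extChartAt (𝓡 n) p₀).left_inv hx]
  have h2 : (2 : ℕ∞ω) ≤ ∞ := mod_cast ENat.LEInfty.out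
  have hτe : ∀ᶠ x in 𝓝 y, ContDiffAt ℝ 2 τ x := (hτs.of_le h2).eventually (by simp)
  have hfe : ∀ᶠ x in 𝓝 y, ContDiffAt ℝ 2 (localRep F p₀) (τ x) :=
    hτs.continuousAt.eventually ((hf.of_le h2).eventually (by simp))
  have hd : fderiv ℝ (localRep F p) =ᶠ[𝓝 y]
      fun x => (fderiv ℝ (localRep F p₀) (τ x)).comp (fderiv ℝ τ x) := by
    filter_upwards [heq.eventually_nhds, hτe, hfe] with x x1 x2 x3
    rw [Filter.EventuallyEq.fderiv_eq x1]
    exact fderiv_comp x (x3.differentiableAt (by norm_num)) (x2.differentiableAt (by norm_num))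
  rw [← hτy]
  refine ⟨fderiv ℝ τ y, fderiv ℝ (fderiv ℝ τ) y, ?_, ?_⟩
  · intro u
    rw [hd.self_of_nhds]
    rfl
  · intro u u'
    have hdf : DifferentiableAt ℝ (fderiv ℝ (localRep F p₀)) (τ y) :=
      ((hf.of_le h2).fderiv_right (m := 1) (by norm_num)).differentiableAt (by norm_num)
    have hdτ : DifferentiableAt ℝ (fderiv ℝ τ) y :=
      ((hτs.of_le h2).fderiv_right (m := 1) (by norm_num)).differentiableAt (by norm_num)
    have h3 := (hdf.hasFDerivAt.comp y (hτs.differentiableAt (by simp)).hasFDerivAt).clm_comp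
      hdτ.hasFDerivAt
    rw [hd.fderiv_eq]
    have h4 := h3.fderiv
    simp only [Function.comp_apply] at h4
    rw [h4]
    exact add_comm _ _

end Charts

/-- The normal space of an immersed hypersurface is a line. -/
theorem exists_smul_of_orthogonal {n : ℕ}
    {D : EuclideanSpace ℝ (Fin n) →L[ℝ] EuclideanSpace ℝ (Fin (n + 1))}
    (hD : Function.Injective D) {N y : EuclideanSpace ℝ (Fin (n + 1))} (hN0 : N ≠ 0)
    (hN : ∀ u, inner ℝ (D u) N = 0) (hy : ∀ u, inner ℝ (D u) y = 0) : ∃ k : ℝ, y = k • N := by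
  set L := (D : EuclideanSpace ℝ (Fin n) →ₗ[ℝ] EuclideanSpace ℝ (Fin (n + 1))).range
  have hL : Module.finrank ℝ L = n := by
    rw [LinearMap.finrank_range_of_inj hD, finrank_euclideanSpace_fin]
  have h1 : Module.finrank ℝ Lᗮ = 1 :=
    Submodule.finrank_add_finrank_orthogonal' (by rw [hL, finrank_euclideanSpace_fin])
  have hmem : ∀ x : EuclideanSpace ℝ (Fin (n + 1)), (∀ u, inner ℝ (D u) x = 0) → x ∈ Lᗮ := by
    rintro x hx _ ⟨u, rfl⟩
    exact hx u
  obtain ⟨k, hk⟩ := (finrank_eq_one_iff_of_nonzero' (⟨N, hmem N hN⟩ : Lᗮ)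
    (by simpa using hN0)).1 h1 ⟨y, hmem y hy⟩
  exact ⟨k, by simpa using (congrArg Subtype.val hk).symm⟩

/-! ### The support function of an immersed convex hypersurface. -/

section Support

variable {n : ℕ} {M : Type*} [TopologicalSpace M] [ChartedSpace (EuclideanSpace ℝ (Fin n)) M]
  {F ν : M → EuclideanSpace ℝ (Fin (n + 1))}

/-- The differential of `F` at `p` in the preferred chart. -/
noncomputable def chartDeriv (F : M → EuclideanSpace ℝ (Fin (n + 1))) (p : M) :
    EuclideanSpace ℝ (Fin n) →L[ℝ] EuclideanSpace ℝ (Fin (n + 1)) :=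
  fderiv ℝ (localRep F p) (extChartAt (𝓡 n) p p)

/-- The second differential of `F` at `p` in the preferred chart. -/
noncomputable def chartDeriv₂ (F : M → EuclideanSpace ℝ (Fin (n + 1))) (p : M) :
    EuclideanSpace ℝ (Fin n) →L[ℝ] EuclideanSpace ℝ (Fin n) →L[ℝ]
      EuclideanSpace ℝ (Fin (n + 1)) :=
  fderiv ℝ (fderiv ℝ (localRep F p)) (extChartAt (𝓡 n) p p)

theorem IsStrictlyConvexWithInteriorNormal.inner_chartDeriv
    (hconv : IsStrictlyConvexWithInteriorNormal F ν) (p : M) (u : EuclideanSpace ℝ (Fin n)) :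
    inner ℝ (chartDeriv F p u) (ν p) = 0 := by
  rw [← (EuclideanSpace.basisFun (Fin n) ℝ).sum_repr u, map_sum, sum_inner]
  refine Finset.sum_eq_zero fun i _ => ?_
  rw [map_smul, inner_smul_left, EuclideanSpace.basisFun_apply]
  have := hconv.orthogonal p i
  rw [show chartDeriv F p (EuclideanSpace.single i 1) = partialDeriv F p i from rfl, this, mul_zero]

variable [IsManifold (𝓡 n) ∞ M]

/-- A strictly convex immersed hypersurface is, near any point, parametrized by its normal
direction, and the Hessian of the support function is the inverse of the shape operator. -/
theorem exists_support_function (hn : 0 < n) (hF : IsSmoothImmersion F)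
    (hconv : IsStrictlyConvexWithInteriorNormal F ν) (p₀ : M) :
    ∃ (w : OrthonormalBasis (Fin (n + 1)) ℝ (EuclideanSpace ℝ (Fin (n + 1))))
      (P : EuclideanSpace ℝ (Fin n) → M) (v : EuclideanSpace ℝ (Fin n) → ℝ),
      P 0 = p₀ ∧ ContDiffAt ℝ 4 v 0 ∧ ∀ᶠ z in 𝓝 0,
        v z = inner ℝ (F (P z)) (w 0 + tangentEmbedding w z) ∧
        (∀ η, fderiv ℝ v z η = inner ℝ (F (P z)) (tangentEmbedding w η)) ∧
        ν (P z) = -(√(1 + ‖z‖ ^ 2))⁻¹ • (w 0 + tangentEmbedding w z) ∧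
        ∃ R, IsGaussParametrized w (chartDeriv F (P z)) (chartDeriv₂ F (P z)) (ν (P z)) R z
          √(1 + ‖z‖ ^ 2) (fderiv ℝ (fderiv ℝ v) z) := by
  obtain ⟨w, hw⟩ := Orthonormal.exists_orthonormalBasis_extension_of_card_eq (𝕜 := ℝ)
    (E := EuclideanSpace ℝ (Fin (n + 1))) (ι := Fin (n + 1)) (by simp)
    (v := fun _ => -ν p₀) (s := {0}) (by
      refine ⟨fun i => by simp [hconv.norm_eq_one], fun i j hij => ?_⟩
      exact absurd (Subsingleton.elim i j) hij)
  -- The sign makes `v 0 = -⟨F, ν⟩`, which is `K^α > 0` for a shrinker.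
  have hw0 : w 0 = -ν p₀ := hw 0 rfl
  set f := localRep F p₀ with hf
  set x₀ := extChartAt (𝓡 n) p₀ p₀ with hx₀
  have h5 : (5 : ℕ∞ω) ≤ ∞ := mod_cast ENat.LEInfty.out
  have hfs : ContDiffAt ℝ 5 f x₀ :=
    (contDiffAt_localRep hF.contMDiff p₀ (mem_extChartAt_target p₀)).of_le h5
  have hneg : ∀ u, u ≠ 0 → inner ℝ (fderiv ℝ (fderiv ℝ f) x₀ u u) (w 0) < 0 := by
    intro u hu
    have := inner_bilin_pos_of_posDef (hconv.posDef p₀) u hu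
    rw [hw0, inner_neg_right]
    exact neg_neg_of_pos this
  obtain ⟨σ, hσ, hσ0, hnorm⟩ := exists_inverse_gauss_map w hfs (fun u => by
    rw [hw0, inner_neg_right]
    exact neg_eq_zero.2 (hconv.inner_chartDeriv p₀ u)) hneg
  set v : EuclideanSpace ℝ (Fin n) → ℝ :=
    fun z => inner ℝ (f (σ z)) (w 0 + tangentEmbedding w z) with hv
  obtain ⟨hv4, hd1, hd2, hd3⟩ := support_function_derivatives w hfs hσ hσ0 hnorm hv
  refine ⟨w, fun z => (extChartAt (𝓡 n) p₀).symm (σ z), v, ?_, hv4, ?_⟩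
  · simp only [hσ0]
    exact extChartAt_to_inv p₀
  have hNne : ∀ z, w 0 + tangentEmbedding w z ≠ 0 := fun z h0 => by
    have := norm_sq_add_tangentEmbedding w 1 z
    rw [one_smul, h0, norm_zero] at this
    nlinarith [sq_nonneg ‖z‖]
  have htar : ∀ᶠ z in 𝓝 0, σ z ∈ (extChartAt (𝓡 n) p₀).target := by
    refine hσ.continuousAt ?_
    rw [hσ0]
    exact extChartAt_target_mem_nhds p₀
  -- the inverse Gauss map is an immersion
  have hmain : ∀ᶠ z in 𝓝 0, ∃ T : EuclideanSpace ℝ (Fin n) →L[ℝ] EuclideanSpace ℝ (Fin n),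
      Function.Bijective T ∧ Function.Injective (fderiv ℝ f (σ z)) ∧
      Function.Injective (fderiv ℝ σ z) ∧
      (∀ u, chartDeriv F ((extChartAt (𝓡 n) p₀).symm (σ z)) u = fderiv ℝ f (σ z) (T u)) ∧
      ∀ u u', inner ℝ (chartDeriv₂ F ((extChartAt (𝓡 n) p₀).symm (σ z)) u u')
          (w 0 + tangentEmbedding w z)
        = inner ℝ (fderiv ℝ (fderiv ℝ f) (σ z) (T u) (T u')) (w 0 + tangentEmbedding w z) := by
    -- The geometric quantities at a nearby point use that point's own preferred chart, while `σ`
    -- lives in the chart at `p₀`. The extra term in the transformed second derivative is tangential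
    -- and vanishes against the normal.
    filter_upwards [htar, hnorm, hd3] with z z1 z2 z3
    set p := (extChartAt (𝓡 n) p₀).symm (σ z) with hp
    have hps : p ∈ (extChartAt (𝓡 n) p₀).source := (extChartAt (𝓡 n) p₀).map_target z1
    have hcp : extChartAt (𝓡 n) p₀ p = σ z := (extChartAt (𝓡 n) p₀).right_inv z1
    obtain ⟨T, K, hT, hK⟩ := exists_chart_change hF.contMDiff hps
    rw [hcp] at hT hK
    have hinj := hF.injective_fderiv_localRep p
    have hTinj : Function.Injective T := by
      intro u u' h
      refine hinj ?_
      rw [hT, hT, h]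
    have hTsurj : Function.Surjective T :=
      LinearMap.surjective_of_injective (f := (T : EuclideanSpace ℝ (Fin n) →ₗ[ℝ] EuclideanSpace ℝ (Fin n))) hTinj
    have hfinj : Function.Injective (fderiv ℝ f (σ z)) := by
      intro x x' h
      obtain ⟨u, rfl⟩ := hTsurj x
      obtain ⟨u', rfl⟩ := hTsurj x'
      rw [← hT, ← hT] at h
      rw [hinj h]
    refine ⟨T, ⟨hTinj, hTsurj⟩, hfinj, ?_, hT, fun u u' => ?_⟩
    · refine (injective_iff_map_eq_zero _).2 fun η hη => ?_
      -- If `Dσ η = 0`, the embedded `η` is normal, hence a multiple of `w 0 + z`; being orthogonal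
      -- to `w 0`, it must vanish.
      have h1 : ∀ u, inner ℝ (fderiv ℝ f (σ z) u) (tangentEmbedding w η) = 0 := by
        intro u
        have := z3 η u
        rwa [hη, map_zero, _root_.zero_apply, inner_zero_left, zero_add] at this
      obtain ⟨k, hk⟩ := exists_smul_of_orthogonal hfinj (hNne z) z2 h1
      have h2 := inner_tangentEmbedding_zero w η
      rw [hk, inner_smul_left, inner_add_left, inner_tangentEmbedding_zero,
        real_inner_self_eq_norm_sq, w.norm_eq_one] at h2
      simp only [conj_trivial, one_pow, add_zero, mul_one] at h2
      rw [h2, zero_smul] at hk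
      have h3 := inner_tangentEmbedding_tangentEmbedding w η η
      rw [hk, inner_zero_left] at h3
      exact inner_self_eq_zero.1 h3.symm
    · change inner ℝ (fderiv ℝ (fderiv ℝ (localRep F p)) _ u u') _ = _
      rw [hK, inner_add_left, z2, add_zero]
  -- the sign of the normal
  set η₁ : EuclideanSpace ℝ (Fin n) := EuclideanSpace.single ⟨0, hn⟩ 1 with hη₁
  have hη₁0 : η₁ ≠ 0 := fun h0 => by
    have := congrArg norm h0
    simp [hη₁] at this
  have hpos : ∀ᶠ z in 𝓝 0, 0 < fderiv ℝ (fderiv ℝ v) z η₁ η₁ := by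
    have hc : ContinuousAt (fun z => fderiv ℝ (fderiv ℝ v) z η₁ η₁) 0 := by
      have h1 : ContDiffAt ℝ 3 (fderiv ℝ v) 0 := hv4.fderiv_right (by norm_num)
      have h2 : ContDiffAt ℝ 2 (fderiv ℝ (fderiv ℝ v)) 0 := h1.fderiv_right (by norm_num)
      exact (h2.continuousAt.clm_apply continuousAt_const).clm_apply continuousAt_const
    refine hc.eventually (lt_mem_nhds ?_)
    obtain ⟨T, -, -, hinj, -⟩ := hmain.self_of_nhds
    have h1 := hd3.self_of_nhds η₁ (fderiv ℝ σ 0 η₁)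
    change 0 < fderiv ℝ (fderiv ℝ v) 0 η₁ η₁
    rw [hd2.self_of_nhds]
    have h2 := hneg (fderiv ℝ σ 0 η₁) fun h0 => hη₁0 (hinj (h0.trans (map_zero _).symm))
    rw [hσ0, map_zero (tangentEmbedding w), add_zero] at h1
    rw [hσ0]
    linarith
  filter_upwards [hmain, hd1, hd2, hd3, hnorm, hpos] with z ⟨T, hT, hfinj, hσinj, hTD, hTH⟩ z1 z2 z3
    z4 z5
  set p := (extChartAt (𝓡 n) p₀).symm (σ z) with hp
  set N := w 0 + tangentEmbedding w z with hN
  set ρ := √(1 + ‖z‖ ^ 2) with hρ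
  have hρpos : 0 < ρ := Real.sqrt_pos.2 (by positivity)
  have hρsq : ρ ^ 2 = 1 + ‖z‖ ^ 2 := Real.sq_sqrt (by positivity)
  have hNnorm : ‖N‖ = ρ := by
    have := norm_sq_add_tangentEmbedding w 1 z
    rw [one_smul, one_pow, ← hρsq] at this
    exact (pow_left_inj₀ (norm_nonneg _) hρpos.le two_ne_zero).1 this
  let Te := LinearEquiv.ofBijective (T : EuclideanSpace ℝ (Fin n) →ₗ[ℝ]
    EuclideanSpace ℝ (Fin n)) hT
  set R : EuclideanSpace ℝ (Fin n) →ₗ[ℝ] EuclideanSpace ℝ (Fin n) :=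
    Te.symm.toLinearMap ∘ₗ (fderiv ℝ σ z : EuclideanSpace ℝ (Fin n) →ₗ[ℝ] EuclideanSpace ℝ (Fin n)) with hR
  have hTR : ∀ η, T (R η) = fderiv ℝ σ z η := fun η => Te.apply_symm_apply _
  have hRinj : Function.Injective R := Te.symm.injective.comp hσinj
  have hpd : (normalMatrix (chartDeriv₂ F p) (ν p)).PosDef := hconv.posDef p
  obtain ⟨k, hk⟩ := exists_smul_of_orthogonal hfinj (hNne z) z4 (y := ν p) (fun x => by
    obtain ⟨u, rfl⟩ := hT.2 x
    rw [← hTD]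
    exact hconv.inner_chartDeriv p u)
  have hb : ∀ η η', inner ℝ (chartDeriv₂ F p (R η) (R η')) (ν p)
      = -k * fderiv ℝ (fderiv ℝ v) z η' η := by
    intro η η'
    have h1 := z3 η (fderiv ℝ σ z η')
    rw [hk, inner_smul_right, hTH, hTR, hTR, z2]
    linear_combination k * h1
  -- Continuity of `ν` is not part of the data; positivity of the second fundamental form at each
  -- point, compared with that of the Hessian of `v`, fixes the sign.
  have hkneg : k < 0 := by
    have h1 := inner_bilin_pos_of_posDef hpd (R η₁)
      fun h0 => hη₁0 (hRinj (h0.trans (map_zero R).symm))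
    rw [hb] at h1
    by_contra! hk0
    have := mul_nonneg hk0 z5.le
    linarith
  have hkρ : k = -ρ⁻¹ := by
    have h1 := hconv.norm_eq_one p
    rw [hk, norm_smul, hNnorm, Real.norm_eq_abs, abs_of_neg hkneg] at h1
    field_simp
    linarith
  refine ⟨rfl, z1, by rw [hk, hkρ], R, ⟨hF.injective_fderiv_localRep p,
    ⟨hRinj, LinearMap.surjective_of_injective hRinj⟩, hpd, hρpos, hρsq, fun η => ?_,
    fun η η' => ?_, fun η η' => ?_⟩⟩
  · rw [hTD, hTR]
    exact z4 _
  · rw [hTD, hTR]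
    exact z2 η η'
  · rw [inner_bilin_symm_of_posDef hpd, hb, hkρ]
    field_simp

end Support

/-! ### Assembly of the theorem. -/

theorem shrinker_umbilic {n : ℕ} (hn : 2 ≤ n)
    {M : Type*} [TopologicalSpace M]
    [ChartedSpace (EuclideanSpace ℝ (Fin n)) M] [IsManifold (𝓡 n) ∞ M]
    {α : ℝ} (hα : 1 / (n : ℝ) < α)
    {F ν : M → EuclideanSpace ℝ (Fin (n + 1))}
    (hF : IsSmoothImmersion F) (hconv : IsStrictlyConvexWithInteriorNormal F ν)
    (hshrink : IsShrinker α F ν) (p₀ : M) (hmax : ∀ p, wFun α F ν p ≤ wFun α F ν p₀) :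
    IsUmbilic F ν p₀ ∧ ∀ u, inner ℝ (F p₀) (chartDeriv F p₀ u) = 0 := by
  have hn0 : 0 < n := by omega
  have hnR : (0 : ℝ) < n := by exact_mod_cast hn0
  have hα0 : 0 < α := lt_trans (by positivity) hα
  have hnα : 1 < n * α := by
    rw [div_lt_iff₀ hnR] at hα
    linarith
  obtain ⟨w, P, v, hP0, hv4, hev⟩ := exists_support_function hn0 hF hconv p₀
  set c : ℝ := (n * α - 1) / (2 * n * α) with hc
  have hK : ∀ z, v z = inner ℝ (F (P z)) (w 0 + tangentEmbedding w z) →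
      ν (P z) = -(√(1 + ‖z‖ ^ 2))⁻¹ • (w 0 + tangentEmbedding w z) →
      gaussCurvature F ν (P z) ^ α = v z / √(1 + ‖z‖ ^ 2) := by
    intro z h1 h2
    rw [hshrink, h2, inner_smul_right, h1]
    ring
  have hFsq : ∀ z, v z = inner ℝ (F (P z)) (w 0 + tangentEmbedding w z) →
      (∀ η, fderiv ℝ v z η = inner ℝ (F (P z)) (tangentEmbedding w η)) →
      ∑ k, fderiv ℝ v z (EuclideanSpace.basisFun (Fin n) ℝ k) ^ 2 + (v z - fderiv ℝ v z z) ^ 2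
        = ‖F (P z)‖ ^ 2 := by
    intro z h1 h2
    rw [← real_inner_self_eq_norm_sq, inner_eq_frame w, h1, inner_add_right, ← h2 z]
    simp only [EuclideanSpace.basisFun_apply, h2, tangentEmbedding_single]
    simp only [sq]
    ring
  have hwz : ∀ z, wFun α F ν (P z) = gaussCurvature F ν (P z) ^ α
      * (minPrincipalCurvature F ν (P z))⁻¹ - c * ‖F (P z)‖ ^ 2 := fun z => rfl
  have hKpos : ∀ᶠ z in 𝓝 0, 0 < gaussCurvature F ν (P z) := by
    filter_upwards [hev] with z ⟨_, _, _, R, h⟩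
    change 0 < ((gramMatrix (chartDeriv F (P z)))⁻¹
      * normalMatrix (chartDeriv₂ F (P z)) (ν (P z))).det
    rw [h.det_weingarten]
    exact inv_pos.2 (mul_pos h.det_hess_pos (pow_pos h.pos _))
  have hvpos : ∀ᶠ z in 𝓝 0, 0 < v z := by
    filter_upwards [hev, hKpos] with z ⟨h1, _, h3, _⟩ h4
    have h5 := Real.rpow_pos_of_pos h4 α
    rw [hK z h1 h3] at h5
    exact (div_pos_iff_of_pos_right (Real.sqrt_pos.2 (by positivity))).1 h5
  obtain ⟨g1, g2, g3, R₀, g4⟩ := hev.self_of_nhds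
  obtain ⟨m₀, hm₀, hsInf₀, -, hatt⟩ := g4.exists_least_curvature hn0
  obtain ⟨ξ₀, hξ₀, hbξ₀⟩ := hatt rfl
  have hcard : Fintype.card (Fin n) = n := Fintype.card_fin n
  have hmin₀ : minPrincipalCurvature F ν (P 0) = m₀ := hsInf₀
  obtain ⟨⟨m, hm⟩, hgrad⟩ := umbilic_of_local_support_function (EuclideanSpace.basisFun (Fin n) ℝ)
    (by rwa [hcard]) hv4 (β := α⁻¹) (c := c) (W := wFun α F ν p₀) (inv_pos.2 hα0) (by
      rw [hcard, inv_lt_iff_one_lt_mul₀ hα0]; linarith) (by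
      rw [hcard, hc]; field_simp) g4.hess_pos hvpos.self_of_nhds (by
      filter_upwards [hev, hKpos, hvpos] with z ⟨h1, _, h3, R, h⟩ h4 h5
      have h6 := h.det_weingarten
      have h7 := hK z h1 h3
      have h8 : gaussCurvature F ν (P z) = _ := h6
      have hd := h.det_hess_pos
      have hρ := h.pos
      -- Taking logarithms in `K^α = v/ρ`, with `K⁻¹ = ρ^(n+2) det D²v`, yields the equation for
      -- `log det D²v`.
      have h9 := congrArg Real.log h7
      rw [Real.log_rpow h4, h8, Real.log_inv, Real.log_mul hd.ne' (pow_pos hρ _).ne', Real.log_pow,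
        Real.log_div h5.ne' hρ.ne', Real.log_sqrt (by positivity)] at h9
      simp only [EuclideanSpace.basisFun_apply, hcard]
      push_cast at h9
      field_simp
      field_simp at h9
      linarith) (by
      filter_upwards [hev, hvpos] with z ⟨h1, h2, h3, R, h⟩ h5 ξ t
      obtain ⟨m', hm', hsInf, hle, -⟩ := h.exists_least_curvature hn0
      have hmin : minPrincipalCurvature F ν (P z) = m' := hsInf
      have h6 := hmax (P z)
      rw [hwz, hK z h1 h3, hmin] at h6
      rw [hFsq z h1 h2]
      have hρ := h.pos
      have h7 : v z * fderiv ℝ (fderiv ℝ v) z ξ ξ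
          ≤ v z / √(1 + ‖z‖ ^ 2) * m'⁻¹ * (‖ξ + t • z‖ ^ 2 + t ^ 2) := by
        have := mul_le_mul_of_nonneg_left (hle ξ t)
          (show 0 ≤ v z / √(1 + ‖z‖ ^ 2) * m'⁻¹ by positivity)
        refine le_trans (le_of_eq ?_) this
        field_simp
      exact h7.trans (mul_le_mul_of_nonneg_right (by linarith) (by positivity)))
    hξ₀ (by
      have h6 := hFsq 0 g1 g2
      rw [map_zero, sub_zero] at h6
      rw [h6]
      have h7 := hwz 0
      rw [hK 0 g1 g3, hmin₀, hP0] at h7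
      rw [h7, hP0]
      have h8 : fderiv ℝ (fderiv ℝ v) 0 ξ₀ ξ₀ = (√(1 + ‖(0 : EuclideanSpace ℝ (Fin n))‖ ^ 2) * m₀)⁻¹ :=
        eq_inv_of_mul_eq_one_left hbξ₀
      rw [h8]
      field_simp
      ring)
  rw [hP0] at g2 g4
  refine ⟨?_, fun u => ?_⟩
  · exact g4.umbilic_of_hess_eq hn0 rfl hm
  -- Since `Dv = 0` at the origin, `F p₀` has no component along any `w k.succ`; it is a multiple of
  -- the normal `w 0`.
  · obtain ⟨η, rfl⟩ := g4.bijective.2 u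
    have h1 := g4.normal η
    rw [map_zero (tangentEmbedding w), add_zero] at h1
    rw [inner_eq_frame w, h1, mul_zero, zero_add]
    refine Finset.sum_eq_zero fun k _ => ?_
    rw [← tangentEmbedding_single, ← g2, hgrad, _root_.zero_apply, zero_mul]

end GaussShrinker

theorem theorem3p2 {n : ℕ} (hn : 2 ≤ n)
    {M : Type*} [TopologicalSpace M] [T2Space M] [CompactSpace M]
    [ChartedSpace (EuclideanSpace ℝ (Fin n)) M] [IsManifold (𝓡 n) ∞ M]
    (α : ℝ) (hα : α ∈ Set.Ioo (1 / (n : ℝ)) (1 + 1 / (n : ℝ)))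
    (F ν : M → EuclideanSpace ℝ (Fin (n + 1)))
    (hF : GaussShrinker.IsSmoothImmersion F)
    (hconv : GaussShrinker.IsStrictlyConvexWithInteriorNormal F ν)
    (hshrink : GaussShrinker.IsShrinker α F ν)
    (p₀ : M) (hmax : ∀ p, GaussShrinker.wFun α F ν p ≤ GaussShrinker.wFun α F ν p₀) :
    GaussShrinker.IsUmbilic F ν p₀ ∧
      HasMFDerivAt (𝓡 n) 𝓘(ℝ, ℝ) (fun p => ‖F p‖ ^ 2) p₀ 0 := by
  obtain ⟨h1, h2⟩ := GaussShrinker.shrinker_umbilic hn hα.1 hF hconv hshrink p₀ hmax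
  refine ⟨h1, ?_⟩
  have hd : MDifferentiableAt (𝓡 n) 𝓘(ℝ, EuclideanSpace ℝ (Fin (n + 1))) F p₀ :=
    hF.contMDiff.mdifferentiableAt (by simp)
  have h3 : HasMFDerivAt 𝓘(ℝ, EuclideanSpace ℝ (Fin (n + 1))) 𝓘(ℝ, ℝ)
      (fun y : EuclideanSpace ℝ (Fin (n + 1)) => ‖y‖ ^ 2) (F p₀) (2 • innerSL ℝ (F p₀)) :=
    (hasStrictFDerivAt_norm_sq (F p₀)).hasFDerivAt.hasMFDerivAt
  have h4 := h3.comp p₀ hd.hasMFDerivAt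
  refine h4.congr_mfderiv ?_
  ext u
  have h5 := h2 u
  have h6 : mfderiv (𝓡 n) 𝓘(ℝ, EuclideanSpace ℝ (Fin (n + 1))) F p₀ u
      = GaussShrinker.chartDeriv F p₀ u := by
    rw [hd.mfderiv, ModelWithCorners.range_eq_univ, fderivWithin_univ]
    rfl
  change 2 • inner ℝ (F p₀) (mfderiv (𝓡 n) 𝓘(ℝ, EuclideanSpace ℝ (Fin (n + 1))) F p₀ u) = 0
  rw [h6]
  exact (congrArg _ h5).trans (smul_zero 2)
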